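/- Let $d\ge 3$ be a fixed integer. For a positive integer $n$ with $dn$ even, let $\mathcal G(n,d)$ be the random $d$-regular multigraph of the configuration model: attach $d$ half-edges to each of the $n$ labelled vertices, choose a perfect matching of the set of the $dn$ half-edges uniformly at random, and let every matched pair of half-edges be an edge between the corresponding vertices (loops and multiple edges may occur; they do not affect tree-width and tree-depth, which are those of the underlying simple graph). Here the tree-width $\mathrm{tw}(G)$ is the minimum, over all tree decompositions of $G$, of the largest bag size minus one, and the tree-depth $\mathrm{td}(G)$ is the minimum height (number of vertices on a longest root-to-leaf path) of a rooted forest on $V(G)$ in which the two ends of every edge of $G$ are in ancestor–descendant relation. Then there are constants $c>0$ and $C$, depending only on $d$, such that $$\Pr\bigl(cn\le \mathrm{tw}(G)\le Cn\ \text{ and }\ cn\le \mathrm{td}(G)\le Cn\bigr)\longrightarrow 1$$ as $n\to\infty$ with $dn$ even, both for $G$ distributed as $\mathcal G(n,d)$ and for $G$ distributed as $\mathcal G(n,d)$ conditioned on being simple (that is, for a uniformly random simple $d$-regular graph on $n$ labelled vertices). -/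

import Mathlib

open Filter Topology

namespace RandomRegular

/-- A tree decomposition of a graph `G`: a finite tree (with nodes `Fin m`) and a bag of vertices
at every node, such that every vertex and every edge of `G` lies in some bag, and the nodes whose
bags contain a given vertex induce a connected subgraph of the tree. -/
structure TreeDecomposition {V : Type*} (G : SimpleGraph V) where
  m : ℕ
  tree : SimpleGraph (Fin m)
  isTree : tree.IsTree
  bag : Fin m → Finset V
  vertex_mem : ∀ v, ∃ t, v ∈ bag t
  edge_mem : ∀ u v, G.Adj u v → ∃ t, u ∈ bag t ∧ v ∈ bag t
  connected : ∀ v, (tree.induce {t | v ∈ bag t}).Connected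

/-- The width of a tree decomposition: the largest size of a bag, minus one. (All bags are empty
only for the graph without vertices, whose width is taken to be `0`.) -/
def TreeDecomposition.width {V : Type*} {G : SimpleGraph V} (D : TreeDecomposition G) : ℕ :=
  (Finset.univ.sup fun t => (D.bag t).card) - 1

/-- The tree-width of `G`: the minimum width of a tree decomposition of `G`. -/
noncomputable def treeWidth {V : Type*} (G : SimpleGraph V) : ℕ :=
  sInf (Set.range (TreeDecomposition.width (G := G)))

/-- A rooted forest on the vertex set `V`, given by the parent of every vertex (`none` for the
roots) and the level of every vertex, where roots have level `1`. The existence of the levels makes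
the parent function acyclic, and the levels are determined by the parents. -/
structure RootedForest (V : Type*) where
  parent : V → Option V
  level : V → ℕ
  level_root : ∀ v, parent v = none → level v = 1
  level_child : ∀ v u, parent v = some u → level v = level u + 1

namespace RootedForest

/-- `F.IsAncestor u v`: the vertex `u` is a proper ancestor of `v`. -/
def IsAncestor {V : Type*} (F : RootedForest V) : V → V → Prop :=
  Relation.TransGen fun u v => F.parent v = some u

/-- The closure of a rooted forest: two distinct vertices are adjacent if one of them is an
ancestor of the other. -/
def closure {V : Type*} (F : RootedForest V) : SimpleGraph V :=
  SimpleGraph.fromRel F.IsAncestor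

/-- The height of a rooted forest: the number of vertices on a longest path from a root. -/
def height {V : Type*} [Fintype V] (F : RootedForest V) : ℕ :=
  Finset.univ.sup F.level

end RootedForest

/-- The tree-depth of `G`: the minimum height of an elimination forest of `G`, that is, of a rooted
forest on the vertices of `G` whose closure contains `G`. -/
noncomputable def treeDepth {V : Type*} [Fintype V] (G : SimpleGraph V) : ℕ :=
  sInf {h | ∃ F : RootedForest V, G ≤ F.closure ∧ F.height = h}

/-- The configurations on `n` vertices with `d` half-edges (`(v, i)` for `i : Fin d`) at every
vertex `v`: the perfect matchings of the set of half-edges, given as fixed-point-free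
involutions. -/
def pairings (n d : ℕ) : Set (Fin n × Fin d → Fin n × Fin d) :=
  {f | Function.Involutive f ∧ ∀ x, f x ≠ x}

/-- The configurations whose `d`-regular multigraph is simple: no half-edge is matched to a
half-edge at the same vertex (no loops), and distinct half-edges at a vertex lead to distinct
vertices (no multiple edges). -/
def simplePairings (n d : ℕ) : Set (Fin n × Fin d → Fin n × Fin d) :=
  {f ∈ pairings n d | ∀ v, (∀ i, (f (v, i)).1 ≠ v) ∧ Function.Injective fun i => (f (v, i)).1}

/-- The graph underlying the multigraph of a configuration: distinct vertices are adjacent if some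
half-edge at `u` is matched to a half-edge at `v`. Loops and multiplicities of edges are forgotten;
tree-width and tree-depth do not depend on them. -/
def pairingGraph {n d : ℕ} (f : Fin n × Fin d → Fin n × Fin d) : SimpleGraph (Fin n) :=
  SimpleGraph.fromRel fun u v => ∃ i j, f (u, i) = (v, j)

/-- The probability that a uniformly random element of the finite set `S` satisfies `P`. -/
noncomputable def uniformProb {α : Type*} (S : Set α) (P : α → Prop) : ℝ :=
  ({x ∈ S | P x}.ncard : ℝ) / (S.ncard : ℝ)

/-- The numbers `n` of vertices tend to infinity through those with `d * n` even, the ones for which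
`d`-regular (multi)graphs on `n` vertices exist. -/
def regularAtTop (d : ℕ) : Filter ℕ :=
  atTop ⊓ 𝓟 {n | Even (d * n)}

end RandomRegular

/-!
The upper bounds hold for every graph on `n` vertices, with `C = 1`: a path is an elimination forest
of height `n` (`treeDepth_le`), and an elimination forest of height `h` gives a tree decomposition
whose bags are the sets of ancestors of the vertices (`treeWidth_le_treeDepth`). It remains to bound
the tree-width below.

A centroid bag of a tree decomposition of width less than `c * n` separates two sets of at least
`n / 4` vertices each (`TreeDecomposition.exists_separator`). For a fixed pair of the smaller set
`A` and the separator `S`, let `m = d * n / 2` be the number of edges and `k` about half the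
number of half-edges at `A`. When the half-edges at `A` are matched one after the other, the
probability that none of them is matched to a half-edge outside `A` and `S` turns out to be at
most `h.choose k / m.choose k`, where `h` exceeds `k` by at most about `d * #S / 2`
(`card_matchingsOn_avoiding`). The numerator is `exp (o(m))` as `c → 0`, and the denominator is at
least about `7 ^ (m / 4)` since `m / 4 ≤ k ≤ m / 2` up to rounding. There are at most `2 ^ n ≤ 2 ^
(2 * m / 3)` sets `A`, here `3 ≤ d` is used, and few sets `S`. As `7 ^ (1 / 4) > 2 ^ (2 / 3)`, the
union bound shows that a balanced separator of size at most `ε * n` is exponentially unlikely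
(`exists_card_separation_le_exp`).

Conditioning on simple graphs costs only a polynomial factor (`numMatchings_le_mul_card_simple`),
which the exponential bound absorbs. Indeed the expected number of half-edges on loops and multiple
edges is bounded, so that half of all configurations have boundedly many of them, and boundedly many
switchings, each of which can be undone in at most `(d * n) ^ 2` ways, make such a configuration
simple.
-/

namespace RandomRegular

open Finset Function

/-! ### Counting perfect matchings -/

section Matchings

lemma card_sdiff_pair {α : Type*} [DecidableEq α] {s : Finset α} {a b : α} (ha : a ∈ s)
    (hb : b ∈ s) (hne : a ≠ b) : #(s \ {a, b}) + 2 = #s := by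
  rw [← card_pair hne]
  exact card_sdiff_add_card_eq_card (by simp [insert_subset_iff, ha, hb])

variable {α : Type*} [Fintype α] [DecidableEq α]

/-- The perfect matchings of the finite set `s`, encoded as the involutions of the ambient type
whose set of non-fixed points is exactly `s`. -/
def matchingsOn (s : Finset α) : Finset (α → α) :=
  {f | (∀ x, f (f x) = x) ∧ ∀ x, f x ≠ x ↔ x ∈ s}

lemma mem_matchingsOn {s : Finset α} {f : α → α} :
    f ∈ matchingsOn s ↔ (∀ x, f (f x) = x) ∧ ∀ x, f x ≠ x ↔ x ∈ s := by
  simp [matchingsOn]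

/-- The number `1 · 3 · 5 ⋯ (2m - 1)` of perfect matchings of a set with `2m` elements. -/
def numMatchings (m : ℕ) : ℕ := ∏ i ∈ range m, (2 * i + 1)

lemma numMatchings_succ (m : ℕ) : numMatchings (m + 1) = (2 * m + 1) * numMatchings m := by
  rw [numMatchings, prod_range_succ, mul_comm, numMatchings]

lemma numMatchings_pos (m : ℕ) : 0 < numMatchings m :=
  prod_pos fun _ _ => by omega

lemma swap_comp_mem_matchingsOn {s : Finset α} {a b : α} {f : α → α} (hf : f ∈ matchingsOn s)
    (hab : f a = b) : Equiv.swap a b ∘ f ∈ matchingsOn (s \ {a, b}) := by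
  rw [mem_matchingsOn] at hf ⊢
  obtain ⟨h1, h2⟩ := hf
  have hba : f b = a := by rw [← hab, h1]
  have key : ∀ x, x ≠ a → x ≠ b → f x ≠ a ∧ f x ≠ b := by
    intro x hxa hxb
    exact ⟨fun h => hxb (by rw [← h1 x, h, hab]), fun h => hxa (by rw [← h1 x, h, hba])⟩
  have e : ∀ x, (Equiv.swap a b ∘ f) x = if x = a then a else if x = b then b else f x := by
    intro x
    change Equiv.swap a b (f x) = _
    split_ifs with h h'
    · subst h; rw [hab, Equiv.swap_apply_right]
    · subst h'; rw [hba, Equiv.swap_apply_left]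
    · exact Equiv.swap_apply_of_ne_of_ne (key x h h').1 (key x h h').2
  constructor
  · intro x
    rw [e, e x]
    have := h1 x
    have := key x
    grind
  · intro x
    rw [e]
    have := h2 x
    simp only [Finset.mem_sdiff, mem_insert, mem_singleton]
    grind

lemma swap_comp_mem_matchingsOn_of_sdiff {s : Finset α} {a b : α} (ha : a ∈ s) (hb : b ∈ s)
    (hne : a ≠ b) {g : α → α} (hg : g ∈ matchingsOn (s \ {a, b})) :
    Equiv.swap a b ∘ g ∈ matchingsOn s ∧ (Equiv.swap a b ∘ g) a = b := by
  rw [mem_matchingsOn] at hg ⊢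
  obtain ⟨h1, h2⟩ := hg
  have hga : g a = a := by have := h2 a; simp at this; exact this
  have hgb : g b = b := by have := h2 b; simp at this; exact this
  have key : ∀ x, x ≠ a → x ≠ b → g x ≠ a ∧ g x ≠ b := by
    intro x hxa hxb
    exact ⟨fun h => hxa (by rw [← h1 x, h, hga]), fun h => hxb (by rw [← h1 x, h, hgb])⟩
  have e : ∀ x, (Equiv.swap a b ∘ g) x = if x = a then b else if x = b then a else g x := by
    intro x
    change Equiv.swap a b (g x) = _
    split_ifs with h h'
    · subst h; rw [hga, Equiv.swap_apply_left]
    · subst h'; rw [hgb, Equiv.swap_apply_right]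
    · exact Equiv.swap_apply_of_ne_of_ne (key x h h').1 (key x h h').2
  refine ⟨⟨?_, ?_⟩, by rw [e]; simp⟩
  · intro x
    rw [e, e x]
    have := h1 x
    have := key x
    grind
  · intro x
    rw [e]
    have := h2 x
    simp only [Finset.mem_sdiff, mem_insert, mem_singleton] at this
    grind

/-- Removing the pair `{a, b}` maps the matchings that contain it injectively to matchings of the
remaining elements. -/
lemma card_filter_apply_eq_le {s : Finset α} (a b : α) (R R' : (α → α) → Prop)
    [DecidablePred R] [DecidablePred R']
    (h : ∀ f ∈ matchingsOn s, f a = b → R f → R' (Equiv.swap a b ∘ f)) :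
    #{f ∈ matchingsOn s | f a = b ∧ R f} ≤ #{g ∈ matchingsOn (s \ {a, b}) | R' g} := by
  refine card_le_card_of_injOn (fun f => Equiv.swap a b ∘ f) ?_ ?_
  · intro f hf
    simp only [coe_filter, Set.mem_ofPred_eq] at hf ⊢
    exact ⟨swap_comp_mem_matchingsOn hf.1 hf.2.1, h f hf.1 hf.2.1 hf.2.2⟩
  · intro f _ g _ hfg
    exact (Equiv.swap a b).injective.comp_left hfg

lemma card_filter_apply_eq {s : Finset α} {a b : α} (ha : a ∈ s) (hb : b ∈ s) (hne : a ≠ b) :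
    #{f ∈ matchingsOn s | f a = b} = #(matchingsOn (s \ {a, b})) := by
  refine le_antisymm ?_ ?_
  · simpa using card_filter_apply_eq_le (s := s) a b (fun _ => True) (fun _ => True)
      (fun _ _ _ _ => trivial)
  · refine card_le_card_of_injOn (fun f => Equiv.swap a b ∘ f) ?_ ?_
    · intro f hf
      simp only [coe_filter, Set.mem_ofPred_eq]
      exact swap_comp_mem_matchingsOn_of_sdiff ha hb hne hf
    · intro f _ g _ hfg
      exact (Equiv.swap a b).injective.comp_left hfg

lemma card_matchingsOn (m : ℕ) : ∀ s : Finset α, #s = 2 * m →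
    #(matchingsOn s) = numMatchings m := by
  induction m with
  | zero =>
    intro s hs
    have : s = ∅ := by simpa using hs
    subst this
    rw [card_eq_one.2 ⟨id, ?_⟩]
    · simp [numMatchings]
    · ext f
      simp only [mem_matchingsOn, notMem_empty, iff_false, not_not, mem_singleton]
      constructor
      · rintro ⟨-, h⟩; exact funext h
      · rintro rfl; simp
  | succ m ih =>
    intro s hs
    obtain ⟨a, ha⟩ : s.Nonempty := card_pos.1 (by omega)
    have h : ∀ f ∈ matchingsOn s, f a ∈ s.erase a := by
      intro f hf
      rw [mem_matchingsOn] at hf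
      rw [mem_erase, ← hf.2 (f a), hf.1]
      have := (hf.2 a).2 ha
      exact ⟨this, this.symm⟩
    rw [card_eq_sum_card_fiberwise h, sum_congr rfl (g := fun _ => numMatchings m),
      sum_const, card_erase_of_mem ha, hs, numMatchings_succ, smul_eq_mul]
    · rfl
    · intro b hb
      rw [mem_erase] at hb
      rw [card_filter_apply_eq ha hb.2 hb.1.symm]
      apply ih
      have := card_sdiff_pair ha hb.2 hb.1.symm
      omega

lemma card_filter_apply_eq_le_numMatchings {s : Finset α} {m : ℕ} (hs : #s = 2 * (m + 1)) {a b : α}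
    (ha : a ∈ s) (hb : b ∈ s) (hne : a ≠ b) :
    #{f ∈ matchingsOn s | f a = b} ≤ numMatchings m := by
  rw [card_filter_apply_eq ha hb hne, card_matchingsOn m]
  have := card_sdiff_pair ha hb hne
  omega

lemma card_filter_apply_eq_apply_eq_le {s : Finset α} {m : ℕ} (hs : #s = 2 * (m + 2))
    {a b a' b' : α} (ha : a ∈ s) (hb : b ∈ s) (hne : a ≠ b)
    (ha' : a' ∈ s) (hb' : b' ∈ s) (hne' : a' ≠ b') (h1 : a' ≠ a) (h2 : a' ≠ b) (h3 : b' ≠ a)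
    (h4 : b' ≠ b) :
    #{f ∈ matchingsOn s | f a = b ∧ f a' = b'} ≤ numMatchings m := by
  refine (card_filter_apply_eq_le a b (fun f => f a' = b') (fun f => f a' = b') ?_).trans ?_
  · intro f _ _ hf
    simp [hf, Equiv.swap_apply_of_ne_of_ne h3 h4]
  · apply card_filter_apply_eq_le_numMatchings _ (by simp [*]) (by simp [*]) hne'
    have := card_sdiff_pair ha hb hne
    omega

/-- The proportion of matchings of `s` without a pair between `X` and `Y` is at most
`(h choose k) / (m choose k)`. The elements of `X` are matched one after the other: at the `i`-th
step, at most `2h - 2i - 1` of the `2m - 2i - 1` possible partners lie outside `Y`. -/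
lemma card_matchingsOn_avoiding (k : ℕ) : ∀ (m h : ℕ) (s X Y : Finset α), X ⊆ s → Y ⊆ s →
    Disjoint X Y → #s = 2 * m → 2 * k ≤ #X + 1 → #(s \ Y) ≤ 2 * h → h ≤ m →
    #{f ∈ matchingsOn s | ∀ x ∈ X, f x ∉ Y} * m.choose k ≤ numMatchings m * h.choose k := by
  induction k with
  | zero =>
    intro m h s X Y _ _ _ hs _ _ _
    simpa [card_matchingsOn m s hs] using
      card_filter_le (matchingsOn s) (fun f => ∀ x ∈ X, f x ∉ Y)
  | succ k ih =>
    intro m h s X Y hX hY hXY hs hk hh hhm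
    obtain ⟨a, ha⟩ : X.Nonempty := card_pos.1 (by omega)
    have haY : a ∉ Y := disjoint_left.1 hXY ha
    have has : a ∈ s \ Y := Finset.mem_sdiff.2 ⟨hX ha, haY⟩
    have hpos : 0 < #(s \ Y) := card_pos.2 ⟨a, has⟩
    obtain ⟨h, rfl⟩ : ∃ h', h = h' + 1 := ⟨h - 1, by omega⟩
    obtain ⟨m, rfl⟩ : ∃ m', m = m' + 1 := ⟨m - 1, by omega⟩
    have hmaps : ∀ f ∈ ({f ∈ matchingsOn s | ∀ x ∈ X, f x ∉ Y} : Finset _),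
        f a ∈ (s \ Y).erase a := by
      intro f hf
      rw [mem_filter, mem_matchingsOn] at hf
      obtain ⟨hf, hf'⟩ := hf
      rw [mem_erase, Finset.mem_sdiff, ← hf.2 (f a), hf.1]
      have := (hf.2 a).2 (hX ha)
      exact ⟨this, this.symm, hf' a ha⟩
    have hfib : ∀ b ∈ (s \ Y).erase a,
        #{f ∈ ({f ∈ matchingsOn s | ∀ x ∈ X, f x ∉ Y} : Finset _) | f a = b} * m.choose k ≤
          numMatchings m * h.choose k := by
      intro b hb
      rw [mem_erase, Finset.mem_sdiff] at hb
      obtain ⟨hba, hbs, hbY⟩ := hb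
      have hc := card_sdiff_pair (hX ha) hbs hba.symm
      have h1 : #{f ∈ ({f ∈ matchingsOn s | ∀ x ∈ X, f x ∉ Y} : Finset _) | f a = b} ≤
          #{f ∈ matchingsOn (s \ {a, b}) | ∀ x ∈ X \ {a, b}, f x ∉ Y} := by
        rw [filter_filter]
        simp_rw [and_comm (b := _ = b)]
        refine card_filter_apply_eq_le a b _ _ ?_
        intro f _ hfa hf x hx
        rw [Finset.mem_sdiff] at hx
        have := hf x hx.1
        rw [Function.comp_apply, Equiv.swap_apply_def]
        split_ifs <;> assumption
      refine (Nat.mul_le_mul_right _ h1).trans (ih m h _ _ _ ?_ ?_ ?_ ?_ ?_ ?_ ?_)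
      · exact sdiff_subset_sdiff hX (Subset.refl _)
      · intro y hy
        rw [Finset.mem_sdiff, mem_insert, mem_singleton]
        refine ⟨hY hy, ?_⟩
        rintro (rfl | rfl) <;> contradiction
      · exact hXY.mono_left sdiff_subset
      · omega
      · have : #X ≤ #(X \ {a, b}) + 2 := by
          have := le_card_sdiff {a, b} X
          have := card_le_two (a := a) (b := b)
          omega
        omega
      · have : (s \ {a, b}) \ Y = (s \ Y) \ {a, b} := by
          rw [sdiff_sdiff_left, sdiff_sdiff_left, sup_comm]
        rw [this]
        have := card_sdiff_pair has (Finset.mem_sdiff.2 ⟨hbs, hbY⟩) hba.symm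
        omega
      · omega
    have hsum : #{f ∈ matchingsOn s | ∀ x ∈ X, f x ∉ Y} * m.choose k ≤
        (2 * h + 1) * (numMatchings m * h.choose k) := by
      rw [card_eq_sum_card_fiberwise hmaps, sum_mul]
      refine (sum_le_card_nsmul _ _ _ hfib).trans ?_
      rw [smul_eq_mul, card_erase_of_mem has]
      exact Nat.mul_le_mul_right _ (by omega)
    have hm1 := Nat.add_one_mul_choose_eq m k
    have hh1 := Nat.add_one_mul_choose_eq h k
    rw [numMatchings_succ]
    refine Nat.le_of_mul_le_mul_right (c := k + 1) ?_ (by omega)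
    calc _ = (m + 1) * (#{f ∈ matchingsOn s | ∀ x ∈ X, f x ∉ Y} * m.choose k) := by
          rw [mul_assoc, ← hm1]; ring
      _ ≤ (m + 1) * ((2 * h + 1) * (numMatchings m * h.choose k)) := Nat.mul_le_mul_left _ hsum
      _ = ((m + 1) * (2 * h + 1)) * (numMatchings m * h.choose k) := by ring
      _ ≤ ((2 * m + 1) * (h + 1)) * (numMatchings m * h.choose k) :=
          Nat.mul_le_mul_right _ (by nlinarith)
      _ = (2 * m + 1) * numMatchings m * ((h + 1) * h.choose k) := by ring
      _ = _ := by rw [hh1]; ring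

end Matchings

/-! ### Simple configurations -/

section Simple

variable {α V : Type*} [Fintype α] [DecidableEq α] [DecidableEq V]

/-- The half-edges that lie on a loop or on a multiple edge of the multigraph of the matching `f`.
Here `π` sends every half-edge to its vertex. -/
def badHalfEdges (π : α → V) (f : α → α) : Finset α :=
  {x | π (f x) = π x ∨ ∃ x', x' ≠ x ∧ π x' = π x ∧ π (f x') = π (f x)}

lemma mem_badHalfEdges {π : α → V} {f : α → α} {x : α} :
    x ∈ badHalfEdges π f ↔
      π (f x) = π x ∨ ∃ x', x' ≠ x ∧ π x' = π x ∧ π (f x') = π (f x) := by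
  simp [badHalfEdges]

/-- The half-edge `x` is bad if it is matched within its vertex, for which there are at most `d`
ways, or if it and another half-edge `x'` at its vertex are matched to half-edges `y` and `y'` at
another vertex, for which there are at most `d * |α| * d` choices of `x'`, `y` and `y'`. -/
lemma card_mem_badHalfEdges_le {π : α → V} {d m : ℕ} (hπ : ∀ v, #{x | π x = v} ≤ d)
    (hα : Fintype.card α = 2 * (m + 2)) (x : α) :
    #{f ∈ matchingsOn (univ : Finset α) | x ∈ badHalfEdges π f} ≤
      d * numMatchings (m + 1) + d * (2 * (m + 2) * (d * numMatchings m)) := by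
  have hsub : ({f ∈ matchingsOn (univ : Finset α) | x ∈ badHalfEdges π f} : Finset _) ⊆
      (({y | π y = π x} : Finset α).biUnion fun y =>
        {f ∈ matchingsOn (univ : Finset α) | y ≠ x ∧ f x = y}) ∪
      (({x' | π x' = π x} : Finset α).biUnion fun x' => (univ : Finset α).biUnion fun y =>
        ({y' | π y' = π y} : Finset α).biUnion fun y' =>
          {f ∈ matchingsOn (univ : Finset α) | (x' ≠ x ∧ y ≠ x ∧ y ≠ x' ∧ y' ≠ x' ∧ y' ≠ x ∧
            y' ≠ y) ∧ f x = y ∧ f x' = y'}) := by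
    intro f hf
    rw [mem_filter, mem_badHalfEdges] at hf
    obtain ⟨hf, hb⟩ := hf
    have hf' := hf
    rw [mem_matchingsOn] at hf'
    obtain ⟨h1, h2⟩ := hf'
    simp only [mem_univ, iff_true] at h2
    rw [mem_union]
    by_cases hl : π (f x) = π x
    · left
      simp only [mem_biUnion, mem_filter, mem_univ, true_and]
      exact ⟨f x, hl, hf, h2 x, rfl⟩
    · right
      obtain ⟨x', hx', hxx, hyy⟩ := hb.resolve_left hl
      simp only [mem_biUnion, mem_filter, mem_univ, true_and]
      refine ⟨x', hxx, f x, f x', hyy, hf, ⟨hx', h2 x, ?_, h2 x', ?_, ?_⟩, rfl, rfl⟩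
      · intro h; exact hl (by rw [h, hxx])
      · intro h; exact hl (by rw [← hyy, h])
      · intro h; exact hx' (by rw [← h1 x', h, h1])
  refine (card_le_card hsub).trans ((card_union_le _ _).trans (add_le_add ?_ ?_))
  · refine (card_biUnion_le_card_mul _ _ _ fun y _ => ?_).trans (Nat.mul_le_mul_right _ (hπ _))
    by_cases h : y ≠ x
    · rw [filter_congr (q := fun f : α → α => f x = y) (fun f _ => and_iff_right h)]
      exact card_filter_apply_eq_le_numMatchings (by simpa using hα) (mem_univ _) (mem_univ _)
        h.symm
    · simp [h]
  · refine (card_biUnion_le_card_mul _ _ _ fun x' _ => ?_).trans (Nat.mul_le_mul_right _ (hπ _))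
    refine (card_biUnion_le_card_mul _ _ _ fun y _ => ?_).trans
      (Nat.mul_le_mul_right _ (by rw [card_univ, hα]))
    refine (card_biUnion_le_card_mul _ _ _ fun y' _ => ?_).trans (Nat.mul_le_mul_right _ (hπ _))
    by_cases h : x' ≠ x ∧ y ≠ x ∧ y ≠ x' ∧ y' ≠ x' ∧ y' ≠ x ∧ y' ≠ y
    · rw [filter_congr (q := fun f : α → α => f x = y ∧ f x' = y') (fun f _ => and_iff_right h)]
      obtain ⟨h1, h2, h3, h4, h5, h6⟩ := h
      exact card_filter_apply_eq_apply_eq_le (by simpa using hα) (mem_univ _) (mem_univ _)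
        h2.symm (mem_univ _) (mem_univ _) h4.symm h1 h3.symm h5 h6
    · simp [h]

/-- The expected number of half-edges on loops and multiple edges is bounded. -/
lemma sum_card_badHalfEdges_le {π : α → V} {d m : ℕ} (hπ : ∀ v, #{x | π x = v} ≤ d)
    (hα : Fintype.card α = 2 * (m + 3)) :
    ∑ f ∈ matchingsOn (univ : Finset α), #(badHalfEdges π f) ≤
      (2 * d + 4 * d ^ 2) * numMatchings (m + 3) := by
  have h1 : ∑ f ∈ matchingsOn (univ : Finset α), #(badHalfEdges π f) =
      ∑ x : α, #{f ∈ matchingsOn (univ : Finset α) | x ∈ badHalfEdges π f} := by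
    simp_rw [card_filter]
    rw [sum_comm]
    exact sum_congr rfl fun f _ => by simp
  rw [h1]
  refine (sum_le_card_nsmul _ _ _ fun x _ => card_mem_badHalfEdges_le (m := m + 1) hπ hα x).trans ?_
  rw [smul_eq_mul, card_univ, hα, numMatchings_succ (m + 2), numMatchings_succ (m + 1)]
  generalize numMatchings (m + 1) = N
  have e1 : 2 * (m + 3) ≤ 2 * (2 * (m + 2) + 1) := by omega
  have e2 : 4 * (m + 3) ^ 2 ≤ 4 * ((2 * (m + 2) + 1) * (2 * (m + 1) + 1)) := by nlinarith
  calc 2 * (m + 3) * (d * ((2 * (m + 1) + 1) * N) + d * (2 * (m + 1 + 2) * (d * N)))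
      = (2 * (m + 3)) * (d * ((2 * (m + 1) + 1) * N)) + (4 * (m + 3) ^ 2) * (d ^ 2 * N) := by ring
    _ ≤ (2 * (2 * (m + 2) + 1)) * (d * ((2 * (m + 1) + 1) * N)) +
        (4 * ((2 * (m + 2) + 1) * (2 * (m + 1) + 1))) * (d ^ 2 * N) := by gcongr
    _ = _ := by ring

/-- At least half of all matchings have a bounded number of half-edges on loops and multiple
edges, by Markov's inequality. -/
lemma numMatchings_le_two_mul_card_badHalfEdges_le {π : α → V} {d m : ℕ}
    (hπ : ∀ v, #{x | π x = v} ≤ d) (hα : Fintype.card α = 2 * (m + 3)) :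
    numMatchings (m + 3) ≤
      2 * #{f ∈ matchingsOn (univ : Finset α) | #(badHalfEdges π f) ≤ 2 * (2 * d + 4 * d ^ 2)} := by
  set K := 2 * d + 4 * d ^ 2
  have h1 := sum_card_badHalfEdges_le hπ hα
  have h2 := card_filter_add_card_filter_not (s := matchingsOn (univ : Finset α))
    (fun f => #(badHalfEdges π f) ≤ 2 * K)
  rw [card_matchingsOn (m + 3) univ (by simpa using hα)] at h2
  have h3 : #{f ∈ matchingsOn (univ : Finset α) | ¬ #(badHalfEdges π f) ≤ 2 * K} * (2 * K + 1) ≤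
      K * numMatchings (m + 3) := by
    refine le_trans ?_ h1
    rw [← smul_eq_mul]
    refine (card_nsmul_le_sum _ (fun f => #(badHalfEdges π f)) _ fun f hf => ?_).trans
      (sum_le_sum_of_subset (filter_subset _ _))
    rw [mem_filter] at hf
    omega
  set b := #{f ∈ matchingsOn (univ : Finset α) | ¬ #(badHalfEdges π f) ≤ 2 * K}
  by_contra hlt
  have : numMatchings (m + 3) < 2 * b := by omega
  nlinarith

/-- A loop or multiple edge through the half-edge `x` is removed by switching it with a pair
`{y, f y}` far away: the pairs `{x, f x}` and `{y, f y}` become `{x, y}` and `{f x, f y}`. -/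
lemma badHalfEdges_switch {π : α → V} {f : α → α} (h1 : ∀ x, f (f x) = x)
    (h0 : ∀ x, f x ≠ x) {x y : α}
    (hx : x ∈ badHalfEdges π f) (hy : y ∉ badHalfEdges π f)
    (hyx : π y ≠ π x) (hyx' : π y ≠ π (f x)) (hy'x : π (f y) ≠ π x) (hy'x' : π (f y) ≠ π (f x))
    (nyx : ∀ z, π z = π x → π (f z) ≠ π y) (ny'x' : ∀ z, π z = π (f x) → π (f z) ≠ π (f y)) :
    badHalfEdges π (Equiv.swap (f x) y ∘ f ∘ Equiv.swap (f x) y) ⊂ badHalfEdges π f := by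
  set g := Equiv.swap (f x) y ∘ f ∘ Equiv.swap (f x) y with hg
  rw [mem_badHalfEdges] at hy
  push Not at hy
  obtain ⟨hyl, hym⟩ := hy
  have fy_ne := h0 y
  have fx_ne := h0 x
  have xy : x ≠ y := fun h => hyx (by rw [h])
  have fxy : f x ≠ y := fun h => hyx' (by rw [h])
  have xfy : x ≠ f y := fun h => hy'x (by rw [h])
  have fxfy : f x ≠ f y := fun h => hy'x' (by rw [h])
  have hgv : ∀ z, g z = Equiv.swap (f x) y (f (Equiv.swap (f x) y z)) := fun z => rfl
  have gfx : g (f x) = f y := by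
    rw [hgv, Equiv.swap_apply_left, Equiv.swap_apply_of_ne_of_ne fxfy.symm fy_ne]
  have gy : g y = x := by
    rw [hgv, Equiv.swap_apply_right, h1, Equiv.swap_apply_of_ne_of_ne fx_ne.symm xy]
  have gx : g x = y := by
    rw [hgv, Equiv.swap_apply_of_ne_of_ne fx_ne.symm xy, Equiv.swap_apply_left]
  have gfy : g (f y) = f x := by
    rw [hgv, Equiv.swap_apply_of_ne_of_ne fxfy.symm fy_ne, h1, Equiv.swap_apply_right]
  have gz : ∀ z, z ≠ x → z ≠ f x → z ≠ y → z ≠ f y → g z = f z := by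
    intro z z1 z2 z3 z4
    rw [hgv, Equiv.swap_apply_of_ne_of_ne z2 z3, Equiv.swap_apply_of_ne_of_ne]
    · exact fun h => z1 (by rw [← h1 z, h, h1])
    · exact fun h => z4 (by rw [← h, h1])
  clear_value g
  clear hgv hg
  -- Every half-edge at the vertex of one of the four switched half-edges, other than these four,
  -- keeps its partner, which does not lie at the vertex of the new partner.
  have good : ∀ z, z = x ∨ z = f x ∨ z = y ∨ z = f y → z ∉ badHalfEdges π g := by
    intro z hz
    rw [mem_badHalfEdges]
    rintro (h | ⟨z', hz', e1, e2⟩)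
    · rcases hz with rfl | rfl | rfl | rfl <;> grind only
    · by_cases k1 : z' = x
      · grind
      by_cases k2 : z' = f x
      · grind
      by_cases k3 : z' = y
      · grind
      by_cases k4 : z' = f y
      · grind
      rw [gz z' k1 k2 k3 k4] at e2
      have := h1 z'
      have q1 := nyx z'
      have q2 := nyx (f z')
      have q3 := ny'x' z'
      have q4 := ny'x' (f z')
      grind
  rw [ssubset_iff_of_subset]
  · exact ⟨x, hx, good x (Or.inl rfl)⟩
  · intro z hz
    have hz' : ¬ (z = x ∨ z = f x ∨ z = y ∨ z = f y) := fun h => good z h hz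
    push Not at hz'
    have e := gz z hz'.1 hz'.2.1 hz'.2.2.1 hz'.2.2.2
    rw [mem_badHalfEdges] at hz ⊢
    rw [e] at hz
    refine hz.imp_right ?_
    rintro ⟨w, hw, e1, e2⟩
    have hw' : ¬ (w = x ∨ w = f x ∨ w = y ∨ w = f y) := by
      intro h
      exact good w h (mem_badHalfEdges.2 (Or.inr ⟨z, hw.symm, e1.symm, by rw [e, e2]⟩))
    push Not at hw'
    exact ⟨w, hw, e1, by rw [← e2, gz w hw'.1 hw'.2.1 hw'.2.2.1 hw'.2.2.2]⟩

/-- If there are few half-edges on loops and multiple edges, some switching reduces their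
number. -/
lemma exists_switch {π : α → V} {d k : ℕ} (hπ : ∀ v, #{x | π x = v} ≤ d) {f : α → α}
    (hf : f ∈ matchingsOn (univ : Finset α)) (hk : #(badHalfEdges π f) ≤ k)
    (hα : k + 2 * ((2 + 2 * d) * d) < Fintype.card α) (hne : (badHalfEdges π f).Nonempty) :
    ∃ p q, #(badHalfEdges π (Equiv.swap p q ∘ f ∘ Equiv.swap p q)) < #(badHalfEdges π f) := by
  obtain ⟨x, hx⟩ := hne
  rw [mem_matchingsOn] at hf
  obtain ⟨h1, h2⟩ := hf
  have h0 : ∀ x, f x ≠ x := fun x => (h2 x).2 (mem_univ x)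
  -- `N v` is the set of neighbours of `v`, and `W` that of the vertices to be avoided.
  let N : V → Finset V := fun v => ({z | π z = v} : Finset α).image fun z => π (f z)
  have hN : ∀ v, #(N v) ≤ d := fun v => card_image_le.trans (hπ v)
  let W : Finset V := {π x, π (f x)} ∪ (N (π x) ∪ N (π (f x)))
  have hW : #W ≤ 2 + 2 * d := by
    have e1 := card_union_le {π x, π (f x)} (N (π x) ∪ N (π (f x)))
    have e2 := card_union_le (N (π x)) (N (π (f x)))
    have e3 := card_le_two (a := π x) (b := π (f x))
    have e4 := hN (π x)
    have e5 := hN (π (f x))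
    change #({π x, π (f x)} ∪ (N (π x) ∪ N (π (f x)))) ≤ _
    omega
  have hA : #({y | π y ∈ W} : Finset α) ≤ (2 + 2 * d) * d := by
    have : ({y | π y ∈ W} : Finset α) ⊆ W.biUnion fun v => {y | π y = v} := by
      intro y hy
      simpa using hy
    exact (card_le_card this).trans ((card_biUnion_le_card_mul _ _ _ fun v _ => hπ v).trans
      (Nat.mul_le_mul_right _ hW))
  have hA' : #({y | π (f y) ∈ W} : Finset α) ≤ (2 + 2 * d) * d := by
    refine le_trans ?_ hA
    refine card_le_card_of_injOn f (fun y hy => by simpa using hy) ?_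
    intro y _ z _ h
    rw [← h1 y, h, h1]
  obtain ⟨y, hy⟩ : ∃ y, y ∉ badHalfEdges π f ∪ (({y | π y ∈ W} : Finset α) ∪
      ({y | π (f y) ∈ W} : Finset α)) := by
    by_contra! h
    have e0 := card_le_card (show (univ : Finset α) ⊆ _ from fun y _ => h y)
    have e1 := card_union_le (badHalfEdges π f) (({y | π y ∈ W} : Finset α) ∪
      ({y | π (f y) ∈ W} : Finset α))
    have e2 := card_union_le ({y | π y ∈ W} : Finset α) ({y | π (f y) ∈ W} : Finset α)
    rw [card_univ] at e0
    omega
  simp only [mem_union, mem_filter, mem_univ, true_and, not_or] at hy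
  obtain ⟨hyB, hyW, hyW'⟩ := hy
  simp only [W, N, mem_union, mem_insert, mem_singleton, mem_image, mem_filter, mem_univ,
    true_and, not_or, not_exists, not_and] at hyW hyW'
  exact ⟨f x, y, card_lt_card (badHalfEdges_switch h1 h0 hx hyB hyW.1.1 hyW.1.2 hyW'.1.1 hyW'.1.2
    hyW.2.1 hyW'.2.2)⟩

/-- A switching is reversed by switching the same two half-edges again, so that the number of
matchings drops by at most the factor `|α| ^ 2` when the bound on the number of bad half-edges is
lowered by one. Lowering it to `0` leaves the simple configurations. -/
lemma card_badHalfEdges_le_le {π : α → V} {d : ℕ} (hπ : ∀ v, #{x | π x = v} ≤ d) (k : ℕ)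
    (hα : k + 2 * ((2 + 2 * d) * d) < Fintype.card α) :
    #{f ∈ matchingsOn (univ : Finset α) | #(badHalfEdges π f) ≤ k} ≤
      (Fintype.card α ^ 2) ^ k *
        #{f ∈ matchingsOn (univ : Finset α) | badHalfEdges π f = ∅} := by
  induction k with
  | zero => simp
  | succ k ih =>
    have hsub : ({f ∈ matchingsOn (univ : Finset α) | #(badHalfEdges π f) ≤ k + 1} : Finset _) ⊆
        (univ : Finset (α × α)).biUnion fun p =>
          ({f ∈ matchingsOn (univ : Finset α) | #(badHalfEdges π f) ≤ k} : Finset _).image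
            fun g => Equiv.swap p.1 p.2 ∘ g ∘ Equiv.swap p.1 p.2 := by
      intro f hf
      rw [mem_filter] at hf
      simp only [mem_biUnion, mem_univ, true_and, mem_image, mem_filter]
      have hconj : ∀ p q, Equiv.swap p q ∘ (Equiv.swap p q ∘ f ∘ Equiv.swap p q) ∘
          Equiv.swap p q = f := by
        intro p q
        ext z
        simp
      have hmem : ∀ p q, Equiv.swap p q ∘ f ∘ Equiv.swap p q ∈ matchingsOn (univ : Finset α) := by
        intro p q
        have := hf.1
        rw [mem_matchingsOn] at this ⊢
        refine ⟨fun z => by simp [this.1], fun z => ?_⟩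
        simp only [mem_univ, iff_true, Function.comp_apply]
        intro h
        refine (this.2 (Equiv.swap p q z)).2 (mem_univ _) ((Equiv.swap p q).injective ?_)
        rw [h, Equiv.swap_apply_self]
      rcases (badHalfEdges π f).eq_empty_or_nonempty with he | hne
      · obtain ⟨x⟩ : Nonempty α := Fintype.card_pos_iff.1 (by omega)
        exact ⟨(x, x), f, ⟨hf.1, by simp [he]⟩, by ext z; simp⟩
      · obtain ⟨p, q, hpq⟩ := exists_switch hπ hf.1 hf.2 hα hne
        exact ⟨(p, q), _, ⟨hmem p q, by omega⟩, hconj p q⟩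
    refine (card_le_card hsub).trans
      ((card_biUnion_le_card_mul _ _ _ fun p _ => card_image_le).trans ?_)
    rw [card_univ, Fintype.card_prod, pow_succ' (Fintype.card α ^ 2), ← sq, mul_assoc]
    exact Nat.mul_le_mul_left _ (ih (by omega))

/-- The probability that the multigraph of a random matching is simple decreases at most
polynomially in the number of half-edges. -/
lemma numMatchings_le_mul_card_simple (d : ℕ) : ∃ K : ℕ, ∀ {α V : Type} [Fintype α]
    [DecidableEq α] [DecidableEq V] (π : α → V) (m : ℕ), (∀ v, #{x | π x = v} ≤ d) →
    Fintype.card α = 2 * m → K ≤ m → numMatchings m ≤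
      2 * ((2 * m) ^ K * #{f ∈ matchingsOn (univ : Finset α) | badHalfEdges π f = ∅}) := by
  set k := 2 * (2 * d + 4 * d ^ 2) with hk
  refine ⟨2 * k + 2 * ((2 + 2 * d) * d) + 3, ?_⟩
  intro α V _ _ _ π m hπ hα hm
  obtain ⟨m, rfl⟩ : ∃ m', m = m' + 3 := ⟨m - 3, by omega⟩
  refine (numMatchings_le_two_mul_card_badHalfEdges_le hπ hα).trans (Nat.mul_le_mul_left _ ?_)
  refine (card_badHalfEdges_le_le hπ k (by omega)).trans (Nat.mul_le_mul_right _ ?_)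
  rw [← pow_mul, hα]
  exact Nat.pow_le_pow_right (by omega) (by omega)

end Simple

/-! ### Balanced separators from tree decompositions -/

section TreeWidth

/-- Every component `K` of a tree minus a node `t` is entered from `t` through a single neighbour
`t'` of `t`, which is closer to all nodes of `K` than `t` is. -/
lemma exists_adj_dist_add_one {ι : Type*} {T : SimpleGraph ι} (hT : T.IsTree) (t : ι)
    (K : (T.induce {t}ᶜ).ConnectedComponent) :
    ∃ t', T.Adj t t' ∧ ∀ u : ({t}ᶜ : Set ι), (T.induce {t}ᶜ).connectedComponentMk u = K →
      T.dist t' u + 1 = T.dist t u := by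
  -- The first step of a shortest path from `t` to a node `u` of `K`.
  have step : ∀ u : ({t}ᶜ : Set ι), ∃ v : ({t}ᶜ : Set ι), T.Adj t v ∧
      (T.induce {t}ᶜ).Reachable v u ∧ T.dist v u + 1 = T.dist t u := by
    rintro ⟨u, hu⟩
    obtain ⟨p, hp, hl⟩ := hT.connected.exists_path_of_dist t u
    cases p with
    | nil => exact absurd rfl hu
    | @cons _ v _ h q =>
      rw [SimpleGraph.Walk.cons_isPath_iff] at hp
      have hv : v ∈ ({t}ᶜ : Set ι) := h.ne'
      refine ⟨⟨v, hv⟩, h, ?_, ?_⟩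
      · refine ⟨q.induce {t}ᶜ ?_⟩
        rintro w hw rfl
        exact hp.2 hw
      · have h1 := SimpleGraph.dist_le q
        have h2 := hT.connected.dist_triangle (u := t) (v := v) (w := u)
        rw [SimpleGraph.dist_eq_one_iff_adj.2 h] at h2
        rw [SimpleGraph.Walk.length_cons] at hl
        change T.dist v u + 1 = T.dist t u
        omega
  obtain ⟨u₀, hu₀⟩ := K.exists_rep
  obtain ⟨v₀, hadj, hr₀, -⟩ := step u₀
  refine ⟨v₀, hadj, fun u hu => ?_⟩
  obtain ⟨v, hv, hr, hd⟩ := step u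
  have hreach : (T.induce {t}ᶜ).Reachable v₀ v := by
    refine hr₀.trans (SimpleGraph.Reachable.trans ?_ hr.symm)
    exact SimpleGraph.ConnectedComponent.exact (hu₀.trans hu.symm)
  -- A second neighbour of `t` in `K` would close a cycle through `t`.
  have : v = v₀ := by
    by_contra hne
    have hb := SimpleGraph.isAcyclic_iff_forall_adj_isBridge.1 hT.isAcyclic hadj
    rw [SimpleGraph.isBridge_iff_forall_walk_mem_edges] at hb
    obtain ⟨w⟩ := hreach.symm
    let q : T.Walk v v₀ := w.map (SimpleGraph.Embedding.induce _).toHom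
    have hmem := hb (SimpleGraph.Walk.cons hv q)
    rw [SimpleGraph.Walk.edges_cons, List.mem_cons] at hmem
    rcases hmem with h | h
    · rw [Sym2.congr_right] at h
      exact hne (Subtype.ext h.symm)
    · have := SimpleGraph.Walk.fst_mem_support_of_mem_edges _ h
      have e : q.support = w.support.map (SimpleGraph.Embedding.induce _).toHom :=
        SimpleGraph.Walk.support_map _ _
      rw [e, List.mem_map] at this
      obtain ⟨x, -, hx⟩ := this
      exact x.2 hx
  rw [← this]
  exact hd

/-- The distance in the tree from the node `t` to the subtree of the nodes whose bags contain
`v`. -/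
noncomputable def TreeDecomposition.distTo {V : Type*} {G : SimpleGraph V}
    (D : TreeDecomposition G) (t : Fin D.m)
    (v : V) : ℕ :=
  sInf ((fun u => D.tree.dist t u) '' {u | v ∈ D.bag u})

lemma TreeDecomposition.exists_distTo_eq {V : Type*} {G : SimpleGraph V} (D : TreeDecomposition G)
    (t : Fin D.m) (v : V) : ∃ u, v ∈ D.bag u ∧ D.tree.dist t u = D.distTo t v := by
  obtain ⟨u, hu⟩ := D.vertex_mem v
  exact Nat.sInf_mem (s := (fun u => D.tree.dist t u) '' {u | v ∈ D.bag u}) ⟨_, u, hu, rfl⟩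

lemma TreeDecomposition.distTo_le {V : Type*} {G : SimpleGraph V} (D : TreeDecomposition G)
    (t : Fin D.m) {u : Fin D.m} {v : V} (h : v ∈ D.bag u) : D.distTo t v ≤ D.tree.dist t u :=
  Nat.sInf_le ⟨u, h, rfl⟩

/-- Some bag of a tree decomposition is a balanced separator: the remaining vertices can be
labelled such that adjacent vertices have the same label and no label occurs on more than half of
all vertices. The bag is that of a node `t` with the least sum of distances to the subtrees of the
vertices, and the label of a vertex is the component of the tree minus `t` that contains its
subtree. -/
lemma TreeDecomposition.exists_centroid {V : Type*} [Fintype V] [DecidableEq V] [Nonempty V]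
    {G : SimpleGraph V} (D : TreeDecomposition G) :
    ∃ (t : Fin D.m) (L : Type) (_ : DecidableEq L) (φ : V → L),
      (∀ u v, u ∉ D.bag t → v ∉ D.bag t → G.Adj u v → φ u = φ v) ∧
      ∀ l, 2 * #{v | v ∉ D.bag t ∧ φ v = l} ≤ Fintype.card V := by
  classical
  obtain ⟨t₀, -⟩ := D.vertex_mem (Classical.arbitrary V)
  obtain ⟨t, -, ht⟩ := exists_min_image (univ : Finset (Fin D.m))
    (fun t => ∑ v, D.distTo t v) ⟨t₀, mem_univ _⟩
  have hne : ∀ {v u}, v ∉ D.bag t → v ∈ D.bag u → u ∈ ({t}ᶜ : Set (Fin D.m)) := by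
    rintro v u hv hu rfl
    exact hv hu
  choose nd hnd using D.vertex_mem
  let comp := (D.tree.induce {t}ᶜ).connectedComponentMk
  have hsame : ∀ {v u} (hv : v ∉ D.bag t) (hu : v ∈ D.bag u),
      comp ⟨u, hne hv hu⟩ = comp ⟨nd v, hne hv (hnd v)⟩ := by
    intro v u hv hu
    refine SimpleGraph.ConnectedComponent.eq.2 ?_
    have hc := (D.connected v).preconnected ⟨u, hu⟩ ⟨nd v, hnd v⟩
    exact hc.map (G' := D.tree.induce {t}ᶜ) ⟨fun s => ⟨s.1, hne hv s.2⟩, fun h => h⟩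
  let φ : V → Option (D.tree.induce {t}ᶜ).ConnectedComponent := fun v =>
    if h : v ∈ D.bag t then none else some (comp ⟨nd v, hne h (hnd v)⟩)
  have hφ : ∀ {v} (h : v ∉ D.bag t), φ v = some (comp ⟨nd v, hne h (hnd v)⟩) :=
    fun h => dif_neg h
  refine ⟨t, _, inferInstance, φ, ?_, ?_⟩
  · intro u v hu hv huv
    obtain ⟨s, hs1, hs2⟩ := D.edge_mem _ _ huv
    rw [hφ hu, hφ hv, ← hsame hu hs1, ← hsame hv hs2]
  · intro l
    set A : Finset V := {v | v ∉ D.bag t ∧ φ v = l} with hA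
    rcases A.eq_empty_or_nonempty with hA0 | ⟨v₀, hv₀⟩
    · simp [hA0]
    obtain ⟨hv₀, hl⟩ := (mem_filter.1 hv₀).2
    obtain ⟨t', hadj, hK⟩ := exists_adj_dist_add_one D.isTree t (comp ⟨nd v₀, hne hv₀ (hnd v₀)⟩)
    have h1 : ∀ v, D.distTo t' v ≤ D.distTo t v + 1 := by
      intro v
      obtain ⟨u, hu, hd⟩ := D.exists_distTo_eq t v
      have h2 := D.isTree.connected.dist_triangle (u := t') (v := t) (w := u)
      rw [SimpleGraph.dist_eq_one_iff_adj.2 hadj.symm] at h2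
      have := D.distTo_le t' hu
      omega
    have h2 : ∀ v ∈ A, D.distTo t' v + 1 ≤ D.distTo t v := by
      intro v hv
      obtain ⟨hv, hvl⟩ := (mem_filter.1 hv).2
      obtain ⟨u, hu, hd⟩ := D.exists_distTo_eq t v
      have h3 : D.tree.dist t' u + 1 = D.tree.dist t u := by
        refine hK ⟨u, hne hv hu⟩ ((hsame hv hu).trans (Option.some_injective _ ?_))
        rw [← hφ hv, ← hφ hv₀, hvl, hl]
      have := D.distTo_le t' hu
      omega
    have h3 := ht t' (mem_univ _)
    have h4 : ∑ v ∈ A, D.distTo t' v + #A ≤ ∑ v ∈ A, D.distTo t v := by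
      rw [card_eq_sum_ones, ← sum_add_distrib]
      exact sum_le_sum h2
    have h5 : ∑ v ∈ Aᶜ, D.distTo t' v ≤ ∑ v ∈ Aᶜ, D.distTo t v + #Aᶜ := by
      rw [card_eq_sum_ones, ← sum_add_distrib]
      exact sum_le_sum fun v _ => h1 v
    rw [← sum_add_sum_compl A, ← sum_add_sum_compl A (fun v => D.distTo t' v)] at h3
    have h6 := card_add_card_compl A
    omega

/-- If no label occurs on more than `n / 2` of the elements of `U`, then the labels can be split
into two groups such that each of them occurs on at least `n / 4` elements. -/
lemma exists_balanced_labels {V L : Type*} [DecidableEq V] [DecidableEq L] (U : Finset V)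
    (φ : V → L) {n : ℕ} (hU : 4 * n ≤ 4 * #U + n)
    (hφ : ∀ l, 2 * #{v ∈ U | φ v = l} ≤ n) :
    ∃ J : Finset L, n ≤ 4 * #{v ∈ U | φ v ∈ J} ∧ n ≤ 4 * #{v ∈ U | φ v ∉ J} := by
  have hadd : ∀ J : Finset L, #{v ∈ U | φ v ∈ J} + #{v ∈ U | φ v ∉ J} = #U := fun J =>
    card_filter_add_card_filter_not _
  by_cases hbig : ∃ l, n ≤ 4 * #{v ∈ U | φ v = l}
  · obtain ⟨l, hl⟩ := hbig
    refine ⟨{l}, ?_⟩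
    have h1 := hadd {l}
    have h2 := hφ l
    simp only [mem_singleton] at h1 ⊢
    omega
  · push Not at hbig
    -- The smallest group occurring on at least `n / 4` elements occurs on at most `n / 2`.
    obtain ⟨J, hJ, hmin⟩ := exists_min_image
      ({J ∈ (U.image φ).powerset | n ≤ 4 * #{v ∈ U | φ v ∈ J}} : Finset (Finset L)) card
      ⟨U.image φ, by
        rw [mem_filter, mem_powerset, filter_true_of_mem (fun v hv => mem_image_of_mem _ hv)]
        exact ⟨Subset.refl _, by omega⟩⟩
    rw [mem_filter, mem_powerset] at hJ
    refine ⟨J, hJ.2, ?_⟩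
    have h1 := hadd J
    rcases J.eq_empty_or_nonempty with rfl | ⟨l, hl⟩
    · simp at hJ h1
      omega
    · have h2 : ¬ n ≤ 4 * #{v ∈ U | φ v ∈ J.erase l} := by
        intro h
        have := hmin (J.erase l)
          (mem_filter.2 ⟨mem_powerset.2 ((erase_subset _ _).trans hJ.1), h⟩)
        have := card_erase_lt_of_mem hl
        omega
      have h3 : ({v ∈ U | φ v ∈ J} : Finset V) ⊆
          {v ∈ U | φ v ∈ J.erase l} ∪ {v ∈ U | φ v = l} := by
        intro v hv
        rw [mem_filter] at hv
        by_cases h : φ v = l <;> simp [hv.1, hv.2, h]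
      have h4 := (card_le_card h3).trans (card_union_le _ _)
      have h5 := hbig l
      omega

/-- `IsSeparation G A S`: no edge of `G` joins `A` to a vertex outside `A` and `S`. -/
def IsSeparation {V : Type*} (G : SimpleGraph V) (A S : Finset V) : Prop :=
  ∀ u ∈ A, ∀ v, v ∉ A → v ∉ S → ¬ G.Adj u v

/-- A graph with a tree decomposition of small width has a small balanced separator `S`. -/
lemma TreeDecomposition.exists_separator {V : Type*} [Fintype V] [DecidableEq V] [Nonempty V]
    {G : SimpleGraph V} (D : TreeDecomposition G) (hD : 4 * (D.width + 1) ≤ Fintype.card V) :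
    ∃ A S : Finset V, #S ≤ D.width + 1 ∧ Disjoint A S ∧ Fintype.card V ≤ 4 * #A ∧
      2 * #A ≤ Fintype.card V ∧ IsSeparation G A S := by
  obtain ⟨t, L, _, φ, hadj, hφ⟩ := D.exists_centroid
  have hS : #(D.bag t) ≤ D.width + 1 := by
    have := le_sup (f := fun t => #(D.bag t)) (mem_univ t)
    simp only [TreeDecomposition.width] at *
    omega
  have hU := card_add_card_compl (D.bag t)
  obtain ⟨J, h1, h2⟩ := exists_balanced_labels (D.bag t)ᶜ φ (n := Fintype.card V) (by omega)
    (fun l => by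
      convert hφ l using 3
      ext v
      simp)
  have h3 : #{v ∈ (D.bag t)ᶜ | φ v ∈ J} + #{v ∈ (D.bag t)ᶜ | φ v ∉ J} = #(D.bag t)ᶜ :=
    card_filter_add_card_filter_not _
  have hdisj : ∀ p : V → Prop, ∀ [DecidablePred p],
      Disjoint ({v ∈ (D.bag t)ᶜ | p v} : Finset V) (D.bag t) := fun p _ =>
    Finset.disjoint_left.2 fun v hv => mem_compl.1 (mem_filter.1 hv).1
  rcases le_total (#{v ∈ (D.bag t)ᶜ | φ v ∈ J}) (#{v ∈ (D.bag t)ᶜ | φ v ∉ J}) with h | h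
  · refine ⟨{v ∈ (D.bag t)ᶜ | φ v ∈ J}, D.bag t, hS, hdisj _, h1, by omega, ?_⟩
    intro u hu v hv hvS huv
    rw [mem_filter, mem_compl] at hu hv
    have := hadj u v hu.1 hvS huv
    exact hv ⟨hvS, this ▸ hu.2⟩
  · refine ⟨{v ∈ (D.bag t)ᶜ | φ v ∉ J}, D.bag t, hS, hdisj _, h2, by omega, ?_⟩
    intro u hu v hv hvS huv
    rw [mem_filter, mem_compl] at hu hv
    have := hadj u v hu.1 hvS huv
    exact hv ⟨hvS, this ▸ hu.2⟩

end TreeWidth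

/-! ### Tree-width and tree-depth -/

section TreeDepth

namespace RootedForest

variable {V : Type*} (F : RootedForest V)

/-- The tree obtained from a rooted forest by joining all roots to a new node `none`. -/
def tree : SimpleGraph (Option V) :=
  SimpleGraph.fromRel fun a b => ∃ v, a = some v ∧ F.parent v = b

lemma tree_adj_parent (v : V) : F.tree.Adj (some v) (F.parent v) := by
  rw [tree, SimpleGraph.fromRel_adj]
  refine ⟨fun h => ?_, Or.inl ⟨v, rfl, rfl⟩⟩
  have := F.level_child v v h.symm
  omega

lemma tree_reachable_none (v : V) : F.tree.Reachable (some v) none := by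
  induction hl : F.level v using Nat.strong_induction_on generalizing v with
  | _ l ih =>
    have hadj := (F.tree_adj_parent v).reachable
    cases hp : F.parent v with
    | none => rwa [hp] at hadj
    | some u =>
      rw [hp] at hadj
      have := F.level_child v u hp
      exact hadj.trans (ih _ (by omega) u rfl)

/-- The tree is connected and has at most as many edges as the forest has vertices, since every edge
joins a vertex to its parent. -/
lemma tree_isTree [Fintype V] : F.tree.IsTree := by
  classical
  have hconn : F.tree.Connected := by
    have h : ∀ a, F.tree.Reachable a none
      | none => SimpleGraph.Reachable.refl _
      | some v => F.tree_reachable_none v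
    exact ⟨fun a b => (h a).trans (h b).symm⟩
  rw [SimpleGraph.isTree_iff_connected_and_card]
  refine ⟨hconn, le_antisymm ?_ hconn.card_vert_le_card_edgeSet_add_one⟩
  have hsurj : Function.Surjective
      (fun v : V => (⟨s(some v, F.parent v), F.tree_adj_parent v⟩ : F.tree.edgeSet)) := by
    rintro ⟨e, he⟩
    induction e with
    | _ a b =>
      rw [SimpleGraph.mem_edgeSet, tree, SimpleGraph.fromRel_adj] at he
      obtain ⟨-, ⟨v, rfl, rfl⟩ | ⟨v, rfl, rfl⟩⟩ := he
      · exact ⟨v, rfl⟩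
      · exact ⟨v, Subtype.ext Sym2.eq_swap⟩
  have : Nat.card F.tree.edgeSet ≤ Nat.card V := Nat.card_le_card_of_surjective _ hsurj
  rw [Nat.card_eq_fintype_card (α := Option V), Fintype.card_option, ← Nat.card_eq_fintype_card]
  omega

/-- The ancestors of `v`, including `v` itself. -/
noncomputable def ancestors [Fintype V] (v : V) : Finset V :=
  open Classical in {u | Relation.ReflTransGen (fun u v => F.parent v = some u) u v}

lemma mem_ancestors [Fintype V] {u v : V} :
    u ∈ F.ancestors v ↔ Relation.ReflTransGen (fun u v => F.parent v = some u) u v := by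
  simp [ancestors]

lemma card_ancestors_le [Fintype V] (v : V) : #(F.ancestors v) ≤ F.level v := by
  classical
  induction hl : F.level v using Nat.strong_induction_on generalizing v with
  | _ l ih =>
    cases hp : F.parent v with
    | none =>
      have h1 : F.ancestors v ⊆ {v} := by
        intro u hu
        rw [mem_ancestors, Relation.ReflTransGen.cases_tail_iff] at hu
        rcases hu with rfl | ⟨w, -, hw⟩
        · simp
        · simp [hp] at hw
      have h2 := F.level_root v hp
      have := card_le_card h1
      rw [card_singleton] at this
      omega
    | some p =>
      have h1 : F.ancestors v ⊆ insert v (F.ancestors p) := by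
        intro u hu
        rw [mem_ancestors, Relation.ReflTransGen.cases_tail_iff] at hu
        rcases hu with rfl | ⟨w, hw', hw⟩
        · simp
        · rw [hp, Option.some_inj] at hw
          subst hw
          exact mem_insert_of_mem (F.mem_ancestors.2 hw')
      have h2 := F.level_child v p hp
      have := (card_le_card h1).trans (card_insert_le _ _)
      have := ih _ (by omega) p rfl
      omega

/-- The tree decomposition whose tree is `F.tree` and whose bag at `v` is the set of ancestors of
`v`. -/
lemma exists_treeDecomposition [Fintype V] {G : SimpleGraph V} (hG : G ≤ F.closure) :
    ∃ D : TreeDecomposition G, D.width ≤ F.height := by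
  classical
  let e := (Fintype.equivFin (Option V)).symm
  let B : Option V → Finset V := fun a => a.elim ∅ F.ancestors
  let iso : F.tree.comap e ≃g F.tree := SimpleGraph.Iso.comap e F.tree
  have hB : ∀ a, #(B a) ≤ F.height
    | none => by simp [B]
    | some v => (F.card_ancestors_le v).trans (le_sup (f := F.level) (mem_univ v))
  refine ⟨⟨Fintype.card (Option V), F.tree.comap e, iso.isTree_iff.2 F.tree_isTree,
    fun t => B (e t), ?_, ?_, ?_⟩, ?_⟩
  · intro v
    refine ⟨e.symm (some v), ?_⟩
    simp only [Equiv.apply_symm_apply]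
    exact F.mem_ancestors.2 .refl
  · have key : ∀ u v, F.IsAncestor u v → ∃ t, u ∈ B (e t) ∧ v ∈ B (e t) := by
      intro u v h
      refine ⟨e.symm (some v), ?_⟩
      simp only [Equiv.apply_symm_apply]
      exact ⟨F.mem_ancestors.2 h.to_reflTransGen, F.mem_ancestors.2 .refl⟩
    intro u v huv
    have := hG huv
    rw [closure, SimpleGraph.fromRel_adj] at this
    rcases this.2 with h | h
    · exact key u v h
    · exact (key v u h).imp fun _ h => h.symm
  · intro v
    have hroot : v ∈ B (e (e.symm (some v))) := by
      simp only [Equiv.apply_symm_apply]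
      exact F.mem_ancestors.2 .refl
    have hreach : ∀ w, Relation.ReflTransGen (fun u v => F.parent v = some u) v w →
        ∃ h : v ∈ B (e (e.symm (some w))),
          ((F.tree.comap e).induce {t | v ∈ B (e t)}).Reachable ⟨e.symm (some w), h⟩
            ⟨e.symm (some v), hroot⟩ := by
      intro w hw
      induction hw with
      | refl => exact ⟨hroot, .refl _⟩
      | @tail x y hx hxy ih =>
        obtain ⟨h, hr⟩ := ih
        have hy : v ∈ B (e (e.symm (some y))) := by
          simp only [Equiv.apply_symm_apply]
          exact F.mem_ancestors.2 (hx.tail hxy)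
        refine ⟨hy, SimpleGraph.Reachable.trans (SimpleGraph.Adj.reachable ?_) hr⟩
        have := F.tree_adj_parent y
        rw [hxy] at this
        simpa using this
    have hall : ∀ t : {t | v ∈ B (e t)},
        ((F.tree.comap e).induce {t | v ∈ B (e t)}).Reachable t ⟨e.symm (some v), hroot⟩ := by
      rintro ⟨t, ht⟩
      obtain ⟨a, rfl⟩ := e.symm.surjective t
      cases a with
      | none => simp [B] at ht
      | some w =>
        have hw : v ∈ B (some w) := by simpa using ht
        exact (hreach w (F.mem_ancestors.1 hw)).2
    exact { preconnected := fun a b => (hall a).trans (hall b).symm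
            nonempty := ⟨⟨_, hroot⟩⟩ }
  · exact (Nat.sub_le _ _).trans (Finset.sup_le fun t _ => hB _)

/-- The path with the vertices `0, 1, …, n - 1`, rooted at `0`. -/
def path (n : ℕ) : RootedForest (Fin n) where
  parent v := if h : v.1 = 0 then none else some ⟨v.1 - 1, by omega⟩
  level v := v.1 + 1
  level_root v h := by
    split_ifs at h with h0
    omega
  level_child v u h := by
    split_ifs at h with h0
    rw [Option.some_inj] at h
    rw [← h]
    change v.1 + 1 = v.1 - 1 + 1 + 1
    omega

lemma path_isAncestor {n : ℕ} {u v : Fin n} (h : u < v) : (path n).IsAncestor u v := by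
  obtain ⟨v, hv⟩ := v
  induction v with
  | zero => exact absurd (Fin.lt_def.1 h) (Nat.not_lt_zero _)
  | succ v ih =>
    have hstep : (path n).parent ⟨v + 1, hv⟩ = some ⟨v, by omega⟩ := by
      simp [path]
    rcases Nat.lt_succ_iff_lt_or_eq.1 (Fin.lt_def.1 h) with h' | h'
    · exact (ih (by omega) h').tail hstep
    · have : u = ⟨v, by omega⟩ := Fin.ext h'
      rw [this]
      exact .single hstep

lemma le_closure_path {n : ℕ} (G : SimpleGraph (Fin n)) : G ≤ (path n).closure := by
  intro u v huv
  rw [closure, SimpleGraph.fromRel_adj]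
  exact ⟨huv.ne, (lt_or_gt_of_ne huv.ne).imp path_isAncestor path_isAncestor⟩

end RootedForest

lemma treeDepth_le {n : ℕ} (G : SimpleGraph (Fin n)) : treeDepth G ≤ n := by
  have h : (RootedForest.path n).height ∈
      {h | ∃ F : RootedForest (Fin n), G ≤ F.closure ∧ F.height = h} :=
    ⟨RootedForest.path n, RootedForest.le_closure_path G, rfl⟩
  refine (Nat.sInf_le h).trans ?_
  exact Finset.sup_le fun v _ => v.2

lemma treeWidth_le_treeDepth {n : ℕ} (G : SimpleGraph (Fin n)) : treeWidth G ≤ treeDepth G := by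
  obtain ⟨F, hF, hh⟩ := Nat.sInf_mem
    (s := {h | ∃ F : RootedForest (Fin n), G ≤ F.closure ∧ F.height = h})
    ⟨_, RootedForest.path n, RootedForest.le_closure_path G, rfl⟩
  obtain ⟨D, hD⟩ := F.exists_treeDecomposition hF
  rw [treeDepth, ← hh]
  exact (Nat.sInf_le (Set.mem_range_self D)).trans hD

lemma exists_width_eq_treeWidth {n : ℕ} (G : SimpleGraph (Fin n)) :
    ∃ D : TreeDecomposition G, D.width = treeWidth G := by
  obtain ⟨D, -⟩ := (RootedForest.path n).exists_treeDecomposition (RootedForest.le_closure_path G)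
  exact Nat.sInf_mem (s := Set.range (TreeDecomposition.width (G := G))) ⟨_, D, rfl⟩

end TreeDepth

/-! ### Estimates of binomial coefficients -/

section Estimates

lemma four_mul_seven_pow_le_choose (j : ℕ) : 4 * 7 ^ j ≤ (4 * (j + 1)).choose (j + 1) := by
  induction j with
  | zero => simp
  | succ i ih =>
    generalize hj : i + 1 = j at *
    have hj1 : 1 ≤ j := by omega
    have e1 := Nat.choose_mul_succ_eq (4 * j) j
    have e2 := Nat.choose_mul_succ_eq (4 * j + 1) j
    have e3 := Nat.choose_mul_succ_eq (4 * j + 2) j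
    have e4 := Nat.add_one_mul_choose_eq (4 * j + 3) j
    rw [show 4 * j + 1 - j = 3 * j + 1 by omega] at e1
    rw [show 4 * j + 1 + 1 - j = 3 * j + 2 by omega, show 4 * j + 1 + 1 = 4 * j + 2 by omega] at e2
    rw [show 4 * j + 2 + 1 - j = 3 * j + 3 by omega, show 4 * j + 2 + 1 = 4 * j + 3 by omega] at e3
    rw [show 4 * j + 3 + 1 = 4 * (j + 1) by omega] at e4
    have e5 : (4 * (j + 1)).choose (j + 1) = 4 * (4 * j + 3).choose j := by
      refine Nat.eq_of_mul_eq_mul_right (show 0 < j + 1 by omega) ?_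
      rw [← e4]
      ring
    have key : (4 * (j + 1)).choose (j + 1) * ((3 * j + 1) * (3 * j + 2) * (3 * j + 3)) =
        (4 * j).choose j * (4 * ((4 * j + 1) * (4 * j + 2) * (4 * j + 3))) := by
      rw [e5]
      calc _ = 4 * (3 * j + 1) * (3 * j + 2) * ((4 * j + 3).choose j * (3 * j + 3)) := by ring
        _ = 4 * (3 * j + 1) * (4 * j + 3) * ((4 * j + 2).choose j * (3 * j + 2)) := by
          rw [← e3]; ring
        _ = 4 * (4 * j + 3) * (4 * j + 2) * ((4 * j + 1).choose j * (3 * j + 1)) := by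
          rw [← e2]; ring
        _ = _ := by rw [← e1]; ring
    have hpoly : 7 * ((3 * j + 1) * (3 * j + 2) * (3 * j + 3)) ≤
        4 * ((4 * j + 1) * (4 * j + 2) * (4 * j + 3)) := by
      obtain ⟨a, rfl⟩ : ∃ a, j = a + 1 := ⟨i, hj.symm⟩
      ring_nf
      nlinarith [Nat.zero_le (a ^ 2), Nat.zero_le (a ^ 3)]
    refine Nat.le_of_mul_le_mul_right (c := (3 * j + 1) * (3 * j + 2) * (3 * j + 3)) ?_
      (by positivity)
    rw [key]
    calc 4 * 7 ^ j * ((3 * j + 1) * (3 * j + 2) * (3 * j + 3))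
        = (4 * 7 ^ i) * (7 * ((3 * j + 1) * (3 * j + 2) * (3 * j + 3))) := by
          rw [← hj, pow_succ]; ring
      _ ≤ _ := Nat.mul_le_mul ih hpoly

/-- The binomial coefficients `m.choose k` with `m / 4 ≤ k ≤ m / 2` exceed `2 ^ (2 * m / 3)` by an
exponential factor, since `7 ^ (1 / 4) > 2 ^ (2 / 3)`. -/
lemma seven_pow_le_two_mul_choose {m k : ℕ} (h1 : m / 4 ≤ k) (h2 : 2 * k ≤ m) :
    7 ^ (m / 4) ≤ 2 * m.choose k := by
  have hmono : m.choose (m / 4) ≤ m.choose k := by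
    induction k, h1 using Nat.le_induction with
    | base => exact le_rfl
    | succ k _ ih =>
      exact (ih (by omega)).trans (Nat.choose_le_succ_of_lt_half_left (by omega))
  have hle : (4 * (m / 4)).choose (m / 4) ≤ m.choose (m / 4) :=
    Nat.choose_le_choose _ (by omega)
  generalize m / 4 = j at *
  cases j with
  | zero =>
    have : 0 < m.choose k := Nat.choose_pos (by omega)
    simp only [pow_zero]
    omega
  | succ j =>
    have := four_mul_seven_pow_le_choose j
    rw [pow_succ]
    omega

/-- Binomial coefficients with a small lower index `i` are small: `t` is chosen small first, and `j`
then small compared to `m`. -/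
lemma choose_le_one_add_pow_mul {t : ℝ} (ht0 : 0 < t) (ht1 : t ≤ 1) {m i j : ℕ} (hij : i ≤ j) :
    (m.choose i : ℝ) ≤ (1 + t) ^ m * t⁻¹ ^ j := by
  have h1 : (m.choose i : ℝ) * t ^ i ≤ (1 + t) ^ m := by
    rcases le_or_gt i m with h | h
    · rw [add_comm, add_pow]
      refine le_trans (le_of_eq ?_) (single_le_sum (f := fun i => t ^ i * 1 ^ (m - i) * m.choose i)
        (fun i _ => by positivity) (mem_range.2 (Nat.lt_succ_of_le h)))
      simp [mul_comm]
    · rw [Nat.choose_eq_zero_of_lt h]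
      simp only [Nat.cast_zero, zero_mul]
      positivity
  calc (m.choose i : ℝ) = m.choose i * t ^ i * t⁻¹ ^ i := by
        rw [mul_assoc, ← mul_pow, mul_inv_cancel₀ ht0.ne', one_pow, mul_one]
    _ ≤ (1 + t) ^ m * t⁻¹ ^ j := by
        gcongr
        exact (one_le_inv₀ ht0).2 ht1

lemma card_filter_card_le_le {V : Type*} [Fintype V] [DecidableEq V] {t : ℝ} (ht0 : 0 < t)
    (ht1 : t ≤ 1) (s : ℕ) :
    (#{S : Finset V | #S ≤ s} : ℝ) ≤ (1 + t) ^ Fintype.card V * t⁻¹ ^ s := by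
  have h1 : ∑ S ∈ ({S : Finset V | #S ≤ s} : Finset (Finset V)), t ^ s ≤
      (1 + t) ^ Fintype.card V := by
    rw [add_comm, ← Fintype.sum_pow_mul_eq_add_pow]
    refine (sum_le_sum (g := fun S : Finset V => t ^ #S * 1 ^ (Fintype.card V - #S))
      fun S hS => ?_).trans (sum_le_sum_of_subset_of_nonneg (subset_univ _)
        fun S _ _ => by positivity)
    rw [one_pow, mul_one]
    exact pow_le_pow_of_le_one ht0.le ht1 (mem_filter.1 hS).2
  rw [sum_const, nsmul_eq_mul] at h1
  calc _ = (#{S : Finset V | #S ≤ s} : ℝ) * t ^ s * t⁻¹ ^ s := by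
        rw [mul_assoc, ← mul_pow, mul_inv_cancel₀ ht0.ne', one_pow, mul_one]
    _ ≤ _ := by gcongr

end Estimates

/-! ### The union bound over separators -/

section UnionBound

variable {n d : ℕ}

lemma card_filter_fst_mem (A : Finset (Fin n)) :
    #{x : Fin n × Fin d | x.1 ∈ A} = d * #A := by
  have : ({x : Fin n × Fin d | x.1 ∈ A} : Finset _) = A ×ˢ univ := by
    ext x
    simp
  rw [this, card_product, card_univ, Fintype.card_fin, mul_comm]

open Classical in
/-- The bound on the number of matchings whose graph has a given separation, where the parameter `t`
of the estimate of the binomial coefficient `h.choose k = h.choose (h - k)` is free. -/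
lemma card_isSeparation_le {m : ℕ} (hm : d * n = 2 * m) {A S : Finset (Fin n)}
    (hAS : Disjoint A S) (hA : n ≤ 4 * #A) (hA' : 2 * #A ≤ n) {t : ℝ} (ht0 : 0 < t)
    (ht1 : t ≤ 1) {s : ℕ} (hS : #S ≤ s) :
    (#{f ∈ matchingsOn (univ : Finset (Fin n × Fin d)) | IsSeparation (pairingGraph f) A S} : ℝ) *
      7 ^ (m / 4) ≤ 2 * (numMatchings m * ((1 + t) ^ m * t⁻¹ ^ (d * s / 2 + 1))) := by
  set X : Finset (Fin n × Fin d) := {x | x.1 ∈ A} with hX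
  set Y : Finset (Fin n × Fin d) := {x | x.1 ∉ A ∪ S} with hY
  have cX : #X = d * #A := card_filter_fst_mem A
  have cY : #(univ \ Y) = d * (#A + #S) := by
    rw [← card_union_of_disjoint hAS, ← card_filter_fst_mem (d := d) (A ∪ S)]
    congr 1
    ext x
    simp only [hY, Finset.mem_sdiff, mem_filter, mem_univ, true_and, not_not]
  have hsub : ({f ∈ matchingsOn (univ : Finset (Fin n × Fin d)) |
      IsSeparation (pairingGraph f) A S} : Finset _) ⊆
      {f ∈ matchingsOn (univ : Finset (Fin n × Fin d)) | ∀ x ∈ X, f x ∉ Y} := by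
    intro f hf
    rw [mem_filter] at hf ⊢
    refine ⟨hf.1, fun x hx hy => ?_⟩
    simp only [hX, hY, mem_filter, mem_univ, true_and, mem_union, not_or] at hx hy
    refine hf.2 x.1 hx (f x).1 hy.1 hy.2 ?_
    rw [pairingGraph, SimpleGraph.fromRel_adj]
    exact ⟨fun h => hy.1 (h ▸ hx), Or.inl ⟨x.2, (f x).2, rfl⟩⟩
  have hASn : #A + #S ≤ n := by
    rw [← card_union_of_disjoint hAS]
    exact (card_le_univ _).trans (by simp)
  have i1 : d * n ≤ 4 * (d * #A) := by nlinarith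
  have i2 : 2 * (d * #A) ≤ d * n := by nlinarith
  have i3 : d * (#A + #S) ≤ d * n := Nat.mul_le_mul_left _ hASn
  have i4 : d * (#A + #S) = d * #A + d * #S := by ring
  have i5 : d * #S ≤ d * s := Nat.mul_le_mul_left _ hS
  set k := d * #A / 2 with hk
  set h := (d * (#A + #S) + 1) / 2 with hh
  have main := card_matchingsOn_avoiding k m h univ X Y (subset_univ _) (subset_univ _)
    (by
      rw [Finset.disjoint_left]
      intro x hx hy
      simp only [hX, hY, mem_filter, mem_univ, true_and, mem_union, not_or] at hx hy
      exact hy.1 hx)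
    (by rw [card_univ, Fintype.card_prod, Fintype.card_fin, Fintype.card_fin, mul_comm, hm])
    (by rw [cX]; omega) (by rw [cY]; omega) (by omega)
  have h7 : 7 ^ (m / 4) ≤ 2 * m.choose k := seven_pow_le_two_mul_choose (by omega) (by omega)
  have hkh : k ≤ h := by omega
  have hc : h.choose k ≤ m.choose (h - k) := by
    rw [← Nat.choose_symm hkh]
    exact Nat.choose_le_choose _ (by omega)
  have hc' : (m.choose (h - k) : ℝ) ≤ (1 + t) ^ m * t⁻¹ ^ (d * s / 2 + 1) :=
    choose_le_one_add_pow_mul ht0 ht1 (by omega)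
  have hcard := card_le_card hsub
  calc _ ≤ (#{f ∈ matchingsOn (univ : Finset (Fin n × Fin d)) | ∀ x ∈ X, f x ∉ Y} : ℝ) *
        (2 * m.choose k) := by
        gcongr
        exact_mod_cast h7
    _ = 2 * ((#{f ∈ matchingsOn (univ : Finset (Fin n × Fin d)) | ∀ x ∈ X, f x ∉ Y} *
        m.choose k : ℕ) : ℝ) := by push_cast; ring
    _ ≤ 2 * ((numMatchings m * m.choose (h - k) : ℕ) : ℝ) := by
        exact mul_le_mul_of_nonneg_left
          (Nat.cast_le.2 (main.trans (Nat.mul_le_mul_left _ hc))) (by norm_num)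
    _ ≤ _ := by
        push_cast
        gcongr

/-- Few matchings have a graph with a balanced separator of size at most `s`. -/
lemma card_exists_separation_le {m : ℕ} (hm : d * n = 2 * m) {t : ℝ} (ht0 : 0 < t)
    (ht1 : t ≤ 1) (s : ℕ) (T : Finset (Fin n × Fin d → Fin n × Fin d))
    (hT : ∀ f ∈ T, f ∈ matchingsOn (univ : Finset (Fin n × Fin d)) ∧ ∃ A S : Finset (Fin n),
      #S ≤ s ∧ Disjoint A S ∧ n ≤ 4 * #A ∧ 2 * #A ≤ n ∧ IsSeparation (pairingGraph f) A S) :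
    (#T : ℝ) * 7 ^ (m / 4) ≤ 2 ^ n * ((1 + t) ^ n * t⁻¹ ^ s) *
      (2 * (numMatchings m * ((1 + t) ^ m * t⁻¹ ^ (d * s / 2 + 1)))) := by
  classical
  let I : Finset (Finset (Fin n) × Finset (Fin n)) :=
    {p ∈ (univ : Finset (Finset (Fin n))) ×ˢ ({S : Finset (Fin n) | #S ≤ s} : Finset _) |
      Disjoint p.1 p.2 ∧ n ≤ 4 * #p.1 ∧ 2 * #p.1 ≤ n}
  have hI : (#I : ℝ) ≤ 2 ^ n * ((1 + t) ^ n * t⁻¹ ^ s) := by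
    have h1 : #I ≤ _ := card_filter_le _ _
    rw [card_product, card_univ, Fintype.card_finset, Fintype.card_fin] at h1
    have h2 := card_filter_card_le_le (V := Fin n) ht0 ht1 s
    rw [Fintype.card_fin] at h2
    calc (#I : ℝ) ≤ ((2 ^ n * #{S : Finset (Fin n) | #S ≤ s} : ℕ) : ℝ) := by exact_mod_cast h1
      _ ≤ _ := by
        push_cast
        gcongr
  have hsub : T ⊆ I.biUnion fun p =>
      {f ∈ matchingsOn (univ : Finset (Fin n × Fin d)) |
        IsSeparation (pairingGraph f) p.1 p.2} := by
    intro f hf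
    obtain ⟨hf, A, S, h1, h2, h3, h4, h5⟩ := hT f hf
    rw [mem_biUnion]
    exact ⟨(A, S), by simp [I, *], by simp [*]⟩
  have h1 := (card_le_card hsub).trans card_biUnion_le
  calc (#T : ℝ) * 7 ^ (m / 4) ≤ ((∑ p ∈ I, #{f ∈ matchingsOn (univ : Finset (Fin n × Fin d)) |
        IsSeparation (pairingGraph f) p.1 p.2} : ℕ) : ℝ) * 7 ^ (m / 4) := by gcongr
    _ = ∑ p ∈ I, (#{f ∈ matchingsOn (univ : Finset (Fin n × Fin d)) |
        IsSeparation (pairingGraph f) p.1 p.2} : ℝ) * 7 ^ (m / 4) := by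
        rw [Nat.cast_sum, sum_mul]
    _ ≤ #I • (2 * (numMatchings m * ((1 + t) ^ m * t⁻¹ ^ (d * s / 2 + 1)))) := by
        refine sum_le_card_nsmul _ _ _ fun p hp => ?_
        simp only [I, mem_filter, mem_product, mem_univ, true_and] at hp
        exact card_isSeparation_le hm hp.2.1 hp.2.2.1 hp.2.2.2 ht0 ht1 hp.1
    _ ≤ _ := by
        rw [nsmul_eq_mul]
        gcongr

/-- The probability that there is a balanced separator with at most `ε * n` vertices is
exponentially small, for a sufficiently small `ε` that does not depend on `d`. -/
lemma exists_card_separation_le_exp : ∃ ε δ B : ℝ, 0 < ε ∧ ε ≤ 1 / 4 ∧ 0 < δ ∧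
    ∀ (d n m s : ℕ) (T : Finset (Fin n × Fin d → Fin n × Fin d)), 3 ≤ d → d * n = 2 * m →
    (s : ℝ) ≤ ε * n →
    (∀ f ∈ T, f ∈ matchingsOn (univ : Finset (Fin n × Fin d)) ∧ ∃ A S : Finset (Fin n),
      #S ≤ s ∧ Disjoint A S ∧ n ≤ 4 * #A ∧ 2 * #A ≤ n ∧ IsSeparation (pairingGraph f) A S) →
    (#T : ℝ) ≤ numMatchings m * Real.exp (B - δ * n) := by
  -- The number of sets `A` contributes `2 / 3 * log 2` to the exponent per edge, and the
  -- denominator `m.choose k` contributes `-log 7 / 4`. The choices of `t` and `ε` keep the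
  -- contribution of the separators to at most `δ / 3`, so that it does not offset the sum `-δ` of
  -- these two.
  set δ : ℝ := Real.log 7 / 4 - 2 / 3 * Real.log 2 with hδ
  have hδ0 : 0 < δ := by
    have h1 : Real.log (2 ^ 8) < Real.log (7 ^ 3) :=
      Real.log_lt_log (by norm_num) (by norm_num)
    rw [Real.log_pow, Real.log_pow] at h1
    push_cast at h1
    linarith
  have hδ1 : δ < 2 := by
    have h1 := Real.log_le_sub_one_of_pos (show (0 : ℝ) < 7 by norm_num)
    have h2 := Real.log_pos (show (1 : ℝ) < 2 by norm_num)
    linarith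
  set t : ℝ := δ / 10 with ht
  have ht0 : 0 < t := by positivity
  have ht1 : t < 1 := by linarith
  set L : ℝ := Real.log t⁻¹ with hL
  have hL0 : 0 < L := Real.log_pos ((one_lt_inv₀ ht0).2 ht1)
  set ε : ℝ := min (δ / (10 * L)) (1 / 4) with hε
  have hε0 : 0 < ε := lt_min (by positivity) (by norm_num)
  have hεL : ε * L ≤ δ / 10 := by
    calc ε * L ≤ δ / (10 * L) * L := by gcongr; exact min_le_left _ _
      _ = δ / 10 := by field_simp
  refine ⟨ε, 2 / 3 * δ, L + Real.log 2 + 3 / 4 * Real.log 7, hε0, min_le_right _ _,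
    by positivity, ?_⟩
  intro d n m s T hd hm hs hT
  have main := card_exists_separation_le hm ht0 ht1.le s T hT
  have e1 : (1 + t : ℝ) ≤ Real.exp t := by
    rw [add_comm]
    exact Real.add_one_le_exp t
  have e2 : (t⁻¹ : ℝ) = Real.exp L := (Real.exp_log (by positivity)).symm
  have e3 : (2 : ℝ) = Real.exp (Real.log 2) := (Real.exp_log (by norm_num)).symm
  have e4 : (7 : ℝ) = Real.exp (Real.log 7) := (Real.exp_log (by norm_num)).symm
  have hmR : (d : ℝ) * n = 2 * m := by exact_mod_cast hm
  have hdR : (3 : ℝ) ≤ d := by exact_mod_cast hd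
  have hn0 : (0 : ℝ) ≤ n := Nat.cast_nonneg n
  have hnm : (3 : ℝ) / 2 * n ≤ m := by nlinarith
  have hds : ((d * s / 2 : ℕ) : ℝ) ≤ ε * m := by
    have h1 : ((d * s / 2 : ℕ) : ℝ) ≤ ((d * s : ℕ) : ℝ) / ((2 : ℕ) : ℝ) := Nat.cast_div_le
    push_cast at h1
    have h2 : (d : ℝ) * s ≤ d * (ε * n) := by gcongr
    have h3 : (d : ℝ) * (ε * n) = ε * (2 * m) := by rw [← hmR]; ring
    linarith
  have hm4 : (m : ℝ) / 4 - 3 / 4 ≤ ((m / 4 : ℕ) : ℝ) := by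
    have : m ≤ 4 * (m / 4) + 3 := by omega
    have : (m : ℝ) ≤ 4 * ((m / 4 : ℕ) : ℝ) + 3 := by exact_mod_cast this
    linarith
  have h7 : (0 : ℝ) < 7 ^ (m / 4) := by positivity
  refine le_of_mul_le_mul_right (main.trans ?_) h7
  have hrhs : Real.exp (Real.log 7 * ((m : ℝ) / 4 - 3 / 4)) ≤ (7 : ℝ) ^ (m / 4) := by
    rw [e4, ← Real.exp_nat_mul, Real.log_exp, mul_comm]
    gcongr
  calc (2 : ℝ) ^ n * ((1 + t) ^ n * t⁻¹ ^ s) *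
      (2 * (numMatchings m * ((1 + t) ^ m * t⁻¹ ^ (d * s / 2 + 1))))
      ≤ Real.exp (Real.log 2) ^ n * (Real.exp t ^ n * Real.exp L ^ s) *
        (Real.exp (Real.log 2) * (numMatchings m * (Real.exp t ^ m *
          Real.exp L ^ (d * s / 2 + 1)))) := by
        rw [← e2, ← e3]
        gcongr
    _ = numMatchings m * Real.exp (n * Real.log 2 + n * t + s * L + Real.log 2 + m * t +
          ((d * s / 2 : ℕ) + 1) * L) := by
        simp only [← Real.exp_nat_mul, Real.exp_add, Nat.cast_add, Nat.cast_one]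
        ring
    _ ≤ numMatchings m * Real.exp ((L + Real.log 2 + 3 / 4 * Real.log 7 - 2 / 3 * δ * n) +
          Real.log 7 * ((m : ℝ) / 4 - 3 / 4)) := by
        refine mul_le_mul_of_nonneg_left (Real.exp_le_exp.2 ?_) (Nat.cast_nonneg _)
        have a1 : (n : ℝ) * Real.log 2 ≤ 2 / 3 * m * Real.log 2 :=
          mul_le_mul_of_nonneg_right (by linarith) (Real.log_nonneg (by norm_num))
        have a2 : (n : ℝ) * t ≤ 2 / 3 * m * t := by
          gcongr
          linarith
        have a3 : (s : ℝ) * L ≤ 2 / 3 * m * (δ / 10) := by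
          calc (s : ℝ) * L ≤ ε * n * L := by gcongr
            _ = n * (ε * L) := by ring
            _ ≤ 2 / 3 * m * (δ / 10) := by
              gcongr
              linarith
        have a4 : ((d * s / 2 : ℕ) : ℝ) * L ≤ m * (δ / 10) := by
          calc ((d * s / 2 : ℕ) : ℝ) * L ≤ ε * m * L := by gcongr
            _ = m * (ε * L) := by ring
            _ ≤ m * (δ / 10) := by gcongr
        have a5 : δ * n ≤ δ * m := mul_le_mul_of_nonneg_left (by linarith) hδ0.le
        have a6 : m * δ = m * (Real.log 7 / 4) - 2 / 3 * m * Real.log 2 := by rw [hδ]; ring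
        have a7 : (m : ℝ) * t = m * δ / 10 := by rw [ht]; ring
        linarith
    _ ≤ _ := by
        rw [Real.exp_add, ← mul_assoc]
        exact mul_le_mul_of_nonneg_left hrhs (by positivity)

end UnionBound

/-! ### The limit -/

section Limit

lemma pairings_eq (n d : ℕ) :
    pairings n d = (matchingsOn (univ : Finset (Fin n × Fin d)) : Set _) := by
  ext f
  simp [pairings, mem_matchingsOn, Function.Involutive]

lemma simplePairings_eq (n d : ℕ) :
    simplePairings n d = (({f ∈ matchingsOn (univ : Finset (Fin n × Fin d)) |
      badHalfEdges Prod.fst f = ∅} : Finset _) : Set _) := by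
  ext f
  rw [simplePairings, pairings_eq]
  simp only [coe_filter, Set.mem_ofPred_eq, mem_coe, and_congr_right_iff]
  intro _
  rw [eq_empty_iff_forall_notMem]
  simp only [mem_badHalfEdges]
  constructor
  · rintro h ⟨v, i⟩ (hl | ⟨⟨w, j⟩, hne, rfl, he⟩)
    · exact (h v).1 i hl
    · exact hne (by rw [(h w).2 he])
  · intro h v
    refine ⟨fun i hi => h (v, i) (Or.inl hi), fun i j hij => ?_⟩
    by_contra hne
    exact h (v, i) (Or.inr ⟨(v, j), by simpa using Ne.symm hne, rfl, hij.symm⟩)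

lemma one_sub_le_uniformProb {α : Type*} {S T : Finset α} {P : α → Prop} {r : ℝ}
    (hS : S.Nonempty) (hT : ∀ x ∈ S, ¬ P x → x ∈ T) (hr : (#T : ℝ) ≤ r * #S) :
    1 - r ≤ uniformProb (S : Set α) P := by
  classical
  have h1 : {x ∈ (S : Set α) | P x} = (({x ∈ S | P x} : Finset α) : Set α) := by
    ext x
    simp
  rw [uniformProb, h1, Set.ncard_coe_finset, Set.ncard_coe_finset]
  have h2 : #({x ∈ S | ¬ P x} : Finset α) ≤ #T :=
    card_le_card fun x hx => hT x (mem_filter.1 hx).1 (mem_filter.1 hx).2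
  have h3 : #({x ∈ S | P x} : Finset α) + #({x ∈ S | ¬ P x} : Finset α) = #S :=
    card_filter_add_card_filter_not _
  have hpos : (0 : ℝ) < #S := by exact_mod_cast card_pos.2 hS
  rw [le_div_iff₀ hpos]
  have h2' : (#({x ∈ S | ¬ P x} : Finset α) : ℝ) ≤ #T := by exact_mod_cast h2
  have h3' : (#({x ∈ S | P x} : Finset α) : ℝ) + #({x ∈ S | ¬ P x} : Finset α) = #S := by
    exact_mod_cast h3
  linarith

lemma uniformProb_le_one {α : Type*} (S : Finset α) (P : α → Prop) :
    uniformProb (S : Set α) P ≤ 1 := by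
  refine div_le_one_of_le₀ ?_ (Nat.cast_nonneg _)
  exact_mod_cast Set.ncard_le_ncard (Set.sep_subset _ _) S.finite_toSet

/-- An event whose complement is exponentially unlikely for random matchings holds with
probability tending to `1` also on random elements of sets whose density among all matchings
decreases at most polynomially. -/
lemma tendsto_uniformProb_one {d K : ℕ} {δ B : ℝ} (hδ : 0 < δ)
    (S T : (n : ℕ) → Finset (Fin n × Fin d → Fin n × Fin d))
    (P : (n : ℕ) → (Fin n × Fin d → Fin n × Fin d) → Prop)
    (hS : ∀ᶠ n in atTop, ∀ m, d * n = 2 * m →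
      numMatchings m ≤ 2 * ((2 * m) ^ K * #(S n)))
    (hT : ∀ᶠ n in atTop, ∀ m, d * n = 2 * m →
      (∀ f ∈ S n, ¬ P n f → f ∈ T n) ∧ (#(T n) : ℝ) ≤ numMatchings m * Real.exp (B - δ * n)) :
    Tendsto (fun n => uniformProb (S n : Set (Fin n × Fin d → Fin n × Fin d)) (P n))
      (regularAtTop d) (𝓝 1) := by
  have hlim : Tendsto (fun n : ℕ => 1 - 2 * d ^ K * Real.exp B *
      ((n : ℝ) ^ K * Real.exp (-δ) ^ n)) (regularAtTop d) (𝓝 1) := by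
    have h1 := tendsto_pow_const_mul_const_pow_of_abs_lt_one K (r := Real.exp (-δ))
      (by rw [Real.abs_exp, Real.exp_lt_one_iff]; linarith)
    have h2 := (h1.const_mul (2 * d ^ K * Real.exp B)).const_sub 1
    rw [mul_zero, sub_zero] at h2
    exact h2.mono_left inf_le_left
  refine tendsto_of_tendsto_of_tendsto_of_le_of_le' hlim tendsto_const_nhds ?_
    (Eventually.of_forall fun n => uniformProb_le_one _ _)
  rw [regularAtTop, eventually_inf_principal]
  filter_upwards [hS, hT] with n hSn hTn heven
  obtain ⟨m, hm⟩ := heven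
  have hm : d * n = 2 * m := by omega
  have h1 := hSn m hm
  obtain ⟨h2, h3⟩ := hTn m hm
  have hne : (S n).Nonempty := by
    have := numMatchings_pos m
    rw [← card_pos]
    by_contra h0
    rw [Nat.eq_zero_of_not_pos h0] at h1
    omega
  refine one_sub_le_uniformProb hne h2 (h3.trans ?_)
  have h1' : (numMatchings m : ℝ) ≤ 2 * ((d * n) ^ K * #(S n)) := by
    have : (numMatchings m : ℝ) ≤ ((2 * ((2 * m) ^ K * #(S n)) : ℕ) : ℝ) := by exact_mod_cast h1
    rw [← hm] at this
    push_cast at this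
    exact this
  calc numMatchings m * Real.exp (B - δ * n)
      ≤ 2 * ((d * n) ^ K * #(S n)) * Real.exp (B - δ * n) := by gcongr
    _ = _ := by
      rw [sub_eq_add_neg, Real.exp_add, ← Real.exp_nat_mul, mul_pow,
        show -(δ * n) = n * -δ by ring]
      ring

end Limit

end RandomRegular

open RandomRegular Finset in
theorem mainTheorem5 (d : ℕ) (hd : 3 ≤ d) :
    ∃ c C : ℝ, 0 < c ∧
      Tendsto
        (fun n : ℕ => RandomRegular.uniformProb (RandomRegular.pairings n d) fun f =>
          (c * n ≤ RandomRegular.treeWidth (RandomRegular.pairingGraph f) ∧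
            RandomRegular.treeWidth (RandomRegular.pairingGraph f) ≤ C * n) ∧
          (c * n ≤ RandomRegular.treeDepth (RandomRegular.pairingGraph f) ∧
            RandomRegular.treeDepth (RandomRegular.pairingGraph f) ≤ C * n))
        (RandomRegular.regularAtTop d) (𝓝 1) ∧
      Tendsto
        (fun n : ℕ => RandomRegular.uniformProb (RandomRegular.simplePairings n d) fun f =>
          (c * n ≤ RandomRegular.treeWidth (RandomRegular.pairingGraph f) ∧
            RandomRegular.treeWidth (RandomRegular.pairingGraph f) ≤ C * n) ∧
          (c * n ≤ RandomRegular.treeDepth (RandomRegular.pairingGraph f) ∧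
            RandomRegular.treeDepth (RandomRegular.pairingGraph f) ≤ C * n))
        (RandomRegular.regularAtTop d) (𝓝 1) := by
  classical
  obtain ⟨ε, δ, B, hε, hε4, hδ, hmain⟩ := exists_card_separation_le_exp
  obtain ⟨K, hK⟩ := numMatchings_le_mul_card_simple d
  -- The matchings whose graph has a balanced separator with at most `ε * n` vertices.
  let T : (n : ℕ) → Finset (Fin n × Fin d → Fin n × Fin d) := fun n =>
    {f ∈ matchingsOn (univ : Finset (Fin n × Fin d)) | ∃ A S : Finset (Fin n),
      #S ≤ ⌊ε * n⌋₊ ∧ Disjoint A S ∧ n ≤ 4 * #A ∧ 2 * #A ≤ n ∧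
        IsSeparation (pairingGraph f) A S}
  have hTcard : ∀ n m, d * n = 2 * m →
      (#(T n) : ℝ) ≤ numMatchings m * Real.exp (B - δ * n) := fun n m hm =>
    hmain d n m ⌊ε * n⌋₊ (T n) hd hm (Nat.floor_le (by positivity))
      fun f hf => mem_filter.1 hf
  -- Small tree-width or tree-depth yields such a separator.
  have hTmem : ∀ᶠ n : ℕ in atTop, ∀ f ∈ matchingsOn (univ : Finset (Fin n × Fin d)),
      ¬ ((ε / 2 * n ≤ treeWidth (pairingGraph f) ∧ (treeWidth (pairingGraph f) : ℝ) ≤ 1 * n) ∧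
        (ε / 2 * n ≤ treeDepth (pairingGraph f) ∧ (treeDepth (pairingGraph f) : ℝ) ≤ 1 * n)) →
      f ∈ T n := by
    have hlarge : ∀ᶠ n : ℕ in atTop, 2 / ε ≤ n :=
      tendsto_natCast_atTop_atTop.eventually_ge_atTop _
    filter_upwards [hlarge, eventually_ge_atTop 1] with n hn hn1 f hf hnot
    rw [mem_filter]
    refine ⟨hf, ?_⟩
    have h1 : (treeWidth (pairingGraph f) : ℝ) ≤ treeDepth (pairingGraph f) := by
      exact_mod_cast treeWidth_le_treeDepth _
    have h2 : (treeDepth (pairingGraph f) : ℝ) ≤ n := by exact_mod_cast treeDepth_le _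
    have h3 : (treeWidth (pairingGraph f) : ℝ) < ε / 2 * n := by
      by_contra! h
      exact hnot ⟨⟨h, by linarith⟩, by linarith, by linarith⟩
    obtain ⟨D, hD⟩ := exists_width_eq_treeWidth (pairingGraph f)
    have h4 : ((D.width + 1 : ℕ) : ℝ) ≤ ε * n := by
      rw [div_le_iff₀ hε] at hn
      push_cast
      rw [hD]
      linarith
    have h5 : 4 * (D.width + 1) ≤ Fintype.card (Fin n) := by
      rw [Fintype.card_fin]
      have : ε * (n : ℝ) ≤ 1 / 4 * n := by gcongr
      have : (4 : ℝ) * ((D.width + 1 : ℕ) : ℝ) ≤ n := by linarith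
      exact_mod_cast this
    have : Nonempty (Fin n) := ⟨⟨0, hn1⟩⟩
    obtain ⟨A, S, hS, hAS, hA, hA', hsep⟩ := D.exists_separator h5
    rw [Fintype.card_fin] at hA hA'
    exact ⟨A, S, hS.trans (Nat.le_floor h4), hAS, hA, hA', hsep⟩
  have hcard : ∀ n m, d * n = 2 * m → Fintype.card (Fin n × Fin d) = 2 * m := by
    intro n m hm
    rw [Fintype.card_prod, Fintype.card_fin, Fintype.card_fin, mul_comm, hm]
  refine ⟨ε / 2, 1, by positivity, ?_, ?_⟩
  · simp_rw [pairings_eq]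
    refine tendsto_uniformProb_one (K := 1) (B := B) hδ
      (fun n => matchingsOn (univ : Finset (Fin n × Fin d))) T _ ?_ ?_
    · filter_upwards [eventually_ge_atTop 1] with n hn m hm
      rw [card_matchingsOn m univ (hcard n m hm)]
      have : 0 < d * n := Nat.mul_pos (by omega) hn
      have := Nat.le_mul_of_pos_left (numMatchings m) (show 0 < 2 * (2 * m) by omega)
      rwa [pow_one, ← mul_assoc]
    · filter_upwards [hTmem] with n hn m hm
      exact ⟨hn, hTcard n m hm⟩
  · simp_rw [simplePairings_eq]
    refine tendsto_uniformProb_one (K := K) (B := B) hδ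
      (fun n => {f ∈ matchingsOn (univ : Finset (Fin n × Fin d)) |
        badHalfEdges Prod.fst f = ∅}) T _ ?_ ?_
    · filter_upwards [eventually_ge_atTop K] with n hn m hm
      refine hK (Prod.fst : Fin n × Fin d → Fin n) m (fun v => ?_) (hcard n m hm) ?_
      · have := card_filter_fst_mem (d := d) {v}
        simp only [mem_singleton, card_singleton, mul_one] at this
        exact this.le
      · nlinarith
    · filter_upwards [hTmem] with n hn m hm
      exact ⟨fun f hf => hn f (mem_filter.1 hf).1, hTcard n m hm⟩
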